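/- Let $A$ be a Weil algebra (a finite-dimensional commutative unital real algebra with a unique maximal ideal $\mathfrak m$, of codimension $1$ over $\mathbb R$) and let $M$ be a paracompact Hausdorff smooth manifold of dimension $n$ with a Poisson bracket $\{\cdot,\cdot\}$ on $C^\infty(M)$. Let $M^A$ be the Weil bundle, i.e. the manifold of all algebra homomorphisms $\xi:C^\infty(M)\to A$ for which there is a point $x\in M$ with $\xi(f)-f(x)\in\mathfrak m$ for all $f\in C^\infty(M)$; a chart $(U,x_1,\dots,x_n)$ of $M$ gives the chart $\xi\mapsto(\xi(x_1),\dots,\xi(x_n))\in A^n$ of $M^A$. For $f\in C^\infty(M)$ put $f^A:M^A\to A$, $f^A(\xi)=\xi(f)$. For $f\in C^\infty(M)$ let $\widetilde{[ad(f)]^A}$ denote the $A$-linear derivation of $C^\infty(M^A,A)$ which maps $C^\infty(M^A)$ into itself and satisfies $\widetilde{[ad(f)]^A}(g^A)=\{f,g\}^A$ for all $g\in C^\infty(M)$. For $p\ge 0$ let $\Lambda^p_{Pois}(M)$ and $\Lambda^p_{Pois}(M^A,\sim)$ be the spaces of skew-symmetric $\mathbb R$-multilinear $p$-forms on $C^\infty(M)$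 with values in $C^\infty(M)$ and in $C^\infty(M^A,A)$ respectively, with the Chevalley–Eilenberg coboundaries $$d\eta(f_1,\dots,f_{p+1})=\sum_{i=1}^{p+1}(-1)^{i+1}\{f_i,\eta(f_1,\dots,\widehat{f_i},\dots,f_{p+1})\}+\sum_{i<j}(-1)^{i+j}\eta(\{f_i,f_j\},f_1,\dots,\widehat{f_i},\dots,\widehat{f_j},\dots,f_{p+1}),$$ $$\tilde d\,\Omega(f_1,\dots,f_{p+1})=\sum_{i=1}^{p+1}(-1)^{i+1}\widetilde{[ad(f_i)]^A}\bigl(\Omega(f_1,\dots,\widehat{f_i},\dots,f_{p+1})\bigr)+\sum_{i<j}(-1)^{i+j}\Omega(\{f_i,f_j\},f_1,\dots,\widehat{f_i},\dots,\widehat{f_j},\dots,f_{p+1}).$$ Then the derivations $\widetilde{[ad(f)]^A}$ exist, and they can be chosen to depend $\mathbb R$-linearly on $f$. For every $p\ge 0$ and every $\eta\in\Lambda^p_{Pois}(M)$ the prolongation $\eta^A(f_1,\dots,f_p)=[\eta(f_1,\dots,f_p)]^A$ takes values in $C^\infty(M^A,A)$ and belongs to $\Lambda^p_{Pois}(M^A,\sim)$,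 and $$\tilde d(\eta^A)=(d\eta)^A .$$ So prolongation is a cochain map. -/

import Mathlib

open scoped Manifold ContDiff Topology

noncomputable section

namespace WeilPoisson

/-! ### The Chevalley–Eilenberg coboundary -/

section ChevalleyEilenberg

variable {L V : Type*} [AddCommGroup L] [Module ℝ L] [AddCommGroup V] [Module ℝ V]

/-- The formula of the Chevalley–Eilenberg coboundary of a `p`-cochain `Ω` on `L` with values
in `V`, for a bracket `br` on `L` and an action `ρ` of `L` on `V`:
`(dΩ)(f₁,…,f_{p+1}) = ∑ᵢ (-1)^{i+1} ρ(fᵢ) (Ω(f₁,…,f̂ᵢ,…,f_{p+1}))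
  + ∑_{i<j} (-1)^{i+j} Ω({fᵢ,fⱼ},f₁,…,f̂ᵢ,…,f̂ⱼ,…,f_{p+1})`.
Indices start at `0` here, so that the first sign is `(-1)^i`.  The pairs `i < j` of
`Fin (p + 1)` are written `(i.castSucc, j.succ)` with `i ≤ j` in `Fin p`, so that the second
sign is `(-1)^(i + j + 1)`.  There are no such pairs for `p = 0`. -/
def ceFormula (br : L →ₗ[ℝ] L →ₗ[ℝ] L) (ρ : L →ₗ[ℝ] V →ₗ[ℝ] V) :
    {p : ℕ} → ((Fin p → L) → V) → (Fin (p + 1) → L) → V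
  | 0, Ω, f => ρ (f 0) (Ω (Fin.removeNth 0 f))
  | p + 1, Ω, f =>
      (∑ i : Fin (p + 2), (-1 : ℝ) ^ (i : ℕ) • ρ (f i) (Ω (i.removeNth f))) +
      ∑ i : Fin (p + 1), ∑ j ∈ Finset.Ici i, (-1 : ℝ) ^ ((i : ℕ) + (j : ℕ) + 1) •
        Ω (Fin.cons (br (f i.castSucc) (f j.succ)) (j.removeNth (i.castSucc.removeNth f)))

/-- The action part of the coboundary, as an alternating map. -/
def ceAction (ρ : L →ₗ[ℝ] V →ₗ[ℝ] V) {p : ℕ} (Ω : L [⋀^Fin p]→ₗ[ℝ] V) :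
    L [⋀^Fin (p + 1)]→ₗ[ℝ] V :=
  AlternatingMap.alternatizeUncurryFin
    { toFun := fun x => (ρ x).compAlternatingMap Ω
      map_add' := fun x y => by ext; simp
      map_smul' := fun c x => by ext; simp }

/-- Minus twice the bracket part of the coboundary, as an alternating map. -/
def ceBracket (br : L →ₗ[ℝ] L →ₗ[ℝ] L) {p : ℕ} (Ω : L [⋀^Fin (p + 1)]→ₗ[ℝ] V) :
    L [⋀^Fin (p + 2)]→ₗ[ℝ] V :=
  AlternatingMap.alternatizeUncurryFin
    (AlternatingMap.alternatizeUncurryFinLM ∘ₗ (br.compr₂ Ω.curryLeft))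

theorem exists_ceFormula (br : L →ₗ[ℝ] L →ₗ[ℝ] L) (hbr : ∀ x, br x x = 0)
    (ρ : L →ₗ[ℝ] V →ₗ[ℝ] V) {p : ℕ} (Ω : L [⋀^Fin p]→ₗ[ℝ] V) :
    ∃ Θ : L [⋀^Fin (p + 1)]→ₗ[ℝ] V, ∀ f, Θ f = ceFormula br ρ Ω f := by
  have hskew : ∀ x y, br y x = - br x y := fun x y => by
    have h := hbr (x + y)
    simp only [map_add, LinearMap.add_apply, hbr, zero_add, add_zero] at h
    exact eq_neg_of_add_eq_zero_left h
  cases p with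
  | zero =>
    refine ⟨ceAction ρ Ω, fun f => ?_⟩
    simp [ceAction, ceFormula, AlternatingMap.alternatizeUncurryFin_apply]
  | succ p =>
    refine ⟨ceAction ρ Ω + (-(1 / 2) : ℝ) • ceBracket br Ω, fun f => ?_⟩
    simp only [ceFormula, AlternatingMap.add_apply, AlternatingMap.smul_apply]
    congr 1
    · simp only [ceAction, AlternatingMap.alternatizeUncurryFin_apply]
      refine Finset.sum_congr rfl fun i _ => ?_
      rcases Nat.even_or_odd (i : ℕ) with h | h <;> simp [h.neg_one_pow]
    · rw [ceBracket,
        AlternatingMap.alternatizeUncurryFin_alternatizeUncurryFinLM_comp_apply, Finset.smul_sum]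
      refine Finset.sum_congr rfl fun i _ => ?_
      rw [Finset.smul_sum]
      refine Finset.sum_congr rfl fun j _ => ?_
      have h2 : ∀ v : V, (-(1 / 2) : ℝ) • (v + v) = -v := fun v => by
        rw [← two_smul ℝ v, smul_smul]; norm_num
      simp only [LinearMap.compr₂_apply, hskew (f i.castSucc) (f j.succ), map_neg,
        AlternatingMap.neg_apply, sub_neg_eq_add, AlternatingMap.curryLeft_apply_apply]
      rcases Nat.even_or_odd ((i : ℕ) + (j : ℕ)) with h | h
      · rw [pow_succ, h.neg_one_pow, h.neg_one_pow, one_smul, h2]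
        simp [Matrix.vecCons]
      · rw [pow_succ, h.neg_one_pow, h.neg_one_pow, neg_one_smul, smul_neg, h2]
        simp [Matrix.vecCons]

/-- The Chevalley–Eilenberg coboundary on skew-symmetric multilinear forms. -/
def ceDiff (br : L →ₗ[ℝ] L →ₗ[ℝ] L) (hbr : ∀ x, br x x = 0)
    (ρ : L →ₗ[ℝ] V →ₗ[ℝ] V) {p : ℕ} (Ω : L [⋀^Fin p]→ₗ[ℝ] V) :
    L [⋀^Fin (p + 1)]→ₗ[ℝ] V where
  toFun := ceFormula br ρ Ω
  map_update_add' f i x y := by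
    obtain ⟨Θ, h⟩ := exists_ceFormula br hbr ρ Ω
    simp only [← h]
    exact Θ.map_update_add f i x y
  map_update_smul' f i c x := by
    obtain ⟨Θ, h⟩ := exists_ceFormula br hbr ρ Ω
    simp only [← h]
    exact Θ.map_update_smul f i c x
  map_eq_zero_of_eq' f i j hf hij := by
    obtain ⟨Θ, h⟩ := exists_ceFormula br hbr ρ Ω
    simp only [← h]
    exact Θ.map_eq_zero_of_eq f hf hij

end ChevalleyEilenberg

/-! ### Weil algebras and the Weil bundle -/

/-- A Weil algebra: a commutative unital real algebra of finite dimension with a unique maximal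
ideal, of codimension `1` over `ℝ`. -/
class IsWeilAlgebra (A : Type*) [CommRing A] [Algebra ℝ A] : Prop where
  isLocalRing : IsLocalRing A
  finite : Module.Finite ℝ A
  finrank_residue : Module.finrank ℝ (A ⧸ IsLocalRing.maximalIdeal A) = 1

attribute [instance] IsWeilAlgebra.isLocalRing IsWeilAlgebra.finite

/-- The algebra `C^∞(M)` of smooth real functions on an `n`-dimensional manifold. -/
abbrev SmoothFn (n : ℕ) (M : Type*) [TopologicalSpace M]
    [ChartedSpace (EuclideanSpace ℝ (Fin n)) M] : Type _ :=
  C^∞⟮𝓡 n, M; 𝓘(ℝ, ℝ), ℝ⟯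

/-- The Weil bundle `M^A`: the infinitely near points of `M` of kind `A`, that is, the algebra
homomorphisms `ξ : C^∞(M) → A` together with a point `x` of `M`, the origin of `ξ`, such that
`ξ(f) - f(x)` lies in the maximal ideal of `A` for all `f`. -/
@[ext]
structure WeilBundle (n : ℕ) (M : Type*) [TopologicalSpace M]
    [ChartedSpace (EuclideanSpace ℝ (Fin n)) M]
    (A : Type*) [CommRing A] [Algebra ℝ A] [IsWeilAlgebra A] where
  origin : M
  toHom : SmoothFn n M →ₐ[ℝ] A
  sub_mem : ∀ f : SmoothFn n M,
    toHom f - algebraMap ℝ A (f origin) ∈ IsLocalRing.maximalIdeal A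

section Bundle

variable {n : ℕ} {M : Type*} [TopologicalSpace M]
  [ChartedSpace (EuclideanSpace ℝ (Fin n)) M]
  {A : Type*} [NormedCommRing A] [NormedAlgebra ℝ A] [IsWeilAlgebra A]

/-- The prolongation `f^A : M^A → A`, `ξ ↦ ξ(f)`. -/
def prolong (f : SmoothFn n M) (ξ : WeilBundle n M A) : A := ξ.toHom f

open Classical in
/-- The value `ξ(f)` at an infinitely near point `ξ` of a real function `f` which is only smooth
near the origin of `ξ`: it is `ξ(g)` for any global smooth function `g` with the same germ
at the origin. -/
def evalGerm (ξ : WeilBundle n M A) (f : M → ℝ) : A :=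
  if h : ∃ g : SmoothFn n M, g =ᶠ[𝓝 ξ.origin] f then ξ.toHom h.choose else 0

/-- The value of an infinitely near point at `g` depends only on the germ of `g` at the
origin. -/
theorem WeilBundle.congr_germ [T2Space M] [IsManifold (𝓡 n) ∞ M] (ξ : WeilBundle n M A)
    {g h : SmoothFn n M} (hgh : g =ᶠ[𝓝 ξ.origin] h) : ξ.toHom g = ξ.toHom h := by
  obtain ⟨b, -, hb⟩ := (SmoothBumpFunction.nhds_basis_support (I := 𝓡 n) hgh).mem_iff.1 hgh
  let χ : SmoothFn n M := ⟨b, b.contMDiff⟩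
  have h0 : χ * (g - h) = 0 := by
    ext y
    by_cases hy : y ∈ Function.support b
    · have : g y = h y := hb hy
      simp [this]
    · have : b y = 0 := by simpa using hy
      change b y * _ = 0
      rw [this, zero_mul]
  have h1 : IsUnit (ξ.toHom χ) := by
    have hm := ξ.sub_mem χ
    have hχ : χ ξ.origin = 1 := b.eq_one
    rw [hχ, map_one] at hm
    by_contra hn
    have := Ideal.sub_mem _ ((IsLocalRing.mem_maximalIdeal _).2 hn) hm
    rw [sub_sub_cancel] at this
    exact (IsLocalRing.mem_maximalIdeal _).1 this isUnit_one
  have h2 : ξ.toHom χ * (ξ.toHom g - ξ.toHom h) = 0 := by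
    rw [← map_sub, ← map_mul, h0, map_zero]
  exact sub_eq_zero.1 (h1.mul_right_eq_zero.1 h2)

theorem evalGerm_eq [T2Space M] [IsManifold (𝓡 n) ∞ M] (ξ : WeilBundle n M A)
    {f : M → ℝ} {g : SmoothFn n M} (hg : g =ᶠ[𝓝 ξ.origin] f) : evalGerm ξ f = ξ.toHom g := by
  have h : ∃ g : SmoothFn n M, g =ᶠ[𝓝 ξ.origin] f := ⟨g, hg⟩
  rw [evalGerm, dif_pos h]
  exact ξ.congr_germ (h.choose_spec.trans hg.symm)

/-- The chart `U^A → A^n`, `ξ ↦ (ξ(x₁), …, ξ(x_n))` of `M^A` which belongs to a local chart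
`(U, x₁, …, x_n)` of `M`; it is meant on the points `ξ` with origin in `U`. -/
def weilChart (e : OpenPartialHomeomorph M (EuclideanSpace ℝ (Fin n)))
    (ξ : WeilBundle n M A) : Fin n → A :=
  fun i => evalGerm ξ (fun y => e y i)

/-- The image in `A^n` of the chart `weilChart e`: the open set of all `a` whose real part
(the image under the augmentation) lies in the image of `e`. -/
def weilChartTarget (A : Type*) [CommRing A] [Algebra ℝ A] [IsWeilAlgebra A]
    (e : OpenPartialHomeomorph M (EuclideanSpace ℝ (Fin n))) : Set (Fin n → A) :=
  {a | ∃ u ∈ e.target, ∀ i, a i - algebraMap ℝ A (u i) ∈ IsLocalRing.maximalIdeal A}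

/-- The local chart `e` of `M` induces a bijection of `{ξ | ξ.origin ∈ e.source}` onto
`weilChartTarget A e`, and these bijections are the charts of the manifold `M^A`.  A function
`φ : M^A → A` is smooth if its expression in each of these charts is smooth. -/
def IsSmooth (φ : WeilBundle n M A → A) : Prop :=
  ∀ e ∈ IsManifold.maximalAtlas (𝓡 n) ∞ M, ∃ F : (Fin n → A) → A,
    ContDiffOn ℝ ∞ F (weilChartTarget A e) ∧
    ∀ ξ : WeilBundle n M A, ξ.origin ∈ e.source → φ ξ = F (weilChart e ξ)

variable (n M A) in
/-- The `A`-algebra `C^∞(M^A, A)`. -/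
def smoothMaps : Subalgebra A (WeilBundle n M A → A) where
  carrier := {φ | IsSmooth φ}
  mul_mem' := by
    intro φ ψ hφ hψ e he
    obtain ⟨F, hF, hF'⟩ := hφ e he
    obtain ⟨G, hG, hG'⟩ := hψ e he
    exact ⟨fun a => F a * G a, hF.mul hG, fun ξ hξ => by simp [hF' ξ hξ, hG' ξ hξ]⟩
  add_mem' := by
    intro φ ψ hφ hψ e he
    obtain ⟨F, hF, hF'⟩ := hφ e he
    obtain ⟨G, hG, hG'⟩ := hψ e he
    exact ⟨fun a => F a + G a, hF.add hG, fun ξ hξ => by simp [hF' ξ hξ, hG' ξ hξ]⟩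
  algebraMap_mem' := fun c e _ => ⟨fun _ => c, contDiffOn_const, fun _ _ => rfl⟩

/-- `φ` belongs to `C^∞(M^A)`, the real-valued functions inside `C^∞(M^A, A)`. -/
def IsRealValued (φ : smoothMaps n M A) : Prop :=
  ∀ ξ, (φ : WeilBundle n M A → A) ξ ∈ Set.range (algebraMap ℝ A)

/-- `D` is the extension `X̃ : C^∞(M^A, A) → C^∞(M^A, A)` of the vector field `X` on `M^A`, seen
as a map from `C^∞(M)` to functions on `M^A`: an `A`-linear derivation which preserves
`C^∞(M^A)` and satisfies `X̃(g^A) = X(g)` for all `g` in `C^∞(M)`. -/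
structure IsTildeOf (X : SmoothFn n M → WeilBundle n M A → A)
    (D : Derivation A (smoothMaps n M A) (smoothMaps n M A)) : Prop where
  real : ∀ φ, IsRealValued φ → IsRealValued (D φ)
  prolong : ∀ (g : SmoothFn n M) (φ : smoothMaps n M A),
    (φ : WeilBundle n M A → A) = prolong g → (D φ : WeilBundle n M A → A) = X g

end Bundle

/-! ### Poisson manifolds, forms and coboundaries -/

/-- A Poisson bracket on `C^∞(M)`: a real Lie algebra bracket which is a derivation of the
commutative algebra `C^∞(M)` in the second variable. -/
structure PoissonBracket (n : ℕ) (M : Type*) [TopologicalSpace M]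
    [ChartedSpace (EuclideanSpace ℝ (Fin n)) M] where
  bracket : SmoothFn n M →ₗ[ℝ] SmoothFn n M →ₗ[ℝ] SmoothFn n M
  bracket_self : ∀ f, bracket f f = 0
  jacobi : ∀ f g h, bracket f (bracket g h) + bracket g (bracket h f) +
    bracket h (bracket f g) = 0
  leibniz : ∀ f g h, bracket f (g * h) = bracket f g * h + g * bracket f h

section Poisson

variable {n : ℕ} {M : Type*} [TopologicalSpace M]
  [ChartedSpace (EuclideanSpace ℝ (Fin n)) M]
  {A : Type*} [NormedCommRing A] [NormedAlgebra ℝ A] [IsWeilAlgebra A]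

variable (n M) in
/-- `Λ^p_Pois(M)`: skew-symmetric `p`-forms on `C^∞(M)` with values in `C^∞(M)`. -/
abbrev PoissonForm (p : ℕ) : Type _ := SmoothFn n M [⋀^Fin p]→ₗ[ℝ] SmoothFn n M

variable (n M A) in
/-- `Λ^p_Pois(M^A, ∼)`: skew-symmetric `p`-forms on `C^∞(M)` with values in `C^∞(M^A, A)`. -/
abbrev WeilForm (p : ℕ) : Type _ := SmoothFn n M [⋀^Fin p]→ₗ[ℝ] smoothMaps n M A

/-- The Poisson coboundary `d` on `M`, for the adjoint representation `f ↦ {f, ·}`. -/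
def PoissonBracket.d (P : PoissonBracket n M) {p : ℕ} (η : PoissonForm n M p) :
    PoissonForm n M (p + 1) :=
  ceDiff P.bracket P.bracket_self P.bracket η

/-- The prolongation to `M^A` of the vector field `ad(f)`, `g ↦ {f, g}^A`. -/
def PoissonBracket.adProlong (P : PoissonBracket n M) (f : SmoothFn n M) :
    SmoothFn n M → WeilBundle n M A → A :=
  fun g => WeilPoisson.prolong (P.bracket f g)

variable (A) in
open Classical in
/-- The representation `f ↦ \widetilde{[ad(f)]^A}` of `C^∞(M)` in `C^∞(M^A, A)`; each
`\widetilde{[ad(f)]^A}` is the `A`-linear derivation characterised by `IsTildeOf`. -/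
def PoissonBracket.tildeAd (P : PoissonBracket n M) :
    SmoothFn n M →ₗ[ℝ] Derivation A (smoothMaps n M A) (smoothMaps n M A) :=
  if h : ∃ ρ : SmoothFn n M →ₗ[ℝ] Derivation A (smoothMaps n M A) (smoothMaps n M A),
      ∀ f, IsTildeOf (P.adProlong f) (ρ f) then h.choose else 0

variable (A) in
/-- `\widetilde{[ad(f)]^A}` as a real endomorphism of `C^∞(M^A, A)`. -/
def PoissonBracket.tildeAdEnd (P : PoissonBracket n M) :
    SmoothFn n M →ₗ[ℝ] smoothMaps n M A →ₗ[ℝ] smoothMaps n M A where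
  toFun f := ((P.tildeAd A f : smoothMaps n M A →ₗ[A] smoothMaps n M A)).restrictScalars ℝ
  map_add' f g := by ext; simp
  map_smul' c f := by ext; simp

/-- The coboundary `d̃` on `Λ_Pois(M^A, ∼)` for the representation
`f ↦ \widetilde{[ad(f)]^A}`. -/
def PoissonBracket.dTilde (P : PoissonBracket n M) {p : ℕ} (Ω : WeilForm n M A p) :
    WeilForm n M A (p + 1) :=
  ceDiff P.bracket P.bracket_self (P.tildeAdEnd A) Ω

/-- `Ω` is the prolongation `η^A` of `η`: `η^A(f₁,…,f_p) = [η(f₁,…,f_p)]^A`. -/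
def IsProlongation {p : ℕ} (η : PoissonForm n M p) (Ω : WeilForm n M A p) : Prop :=
  ∀ f, (Ω f : WeilBundle n M A → A) = prolong (η f)

end Poisson

end WeilPoisson

end

/-!
A smooth function `f` on an open subset of `ℝⁿ` extends to the tuples `a ∈ Aⁿ` with real part in
that subset by its Taylor expansion at the real part of `a`, which is finite because the remaining
part of `a` is nilpotent (`weilExtension`).  Two facts about this extension carry the argument.

* It computes infinitely near points: in a chart `e` of `M`, the value `ξ(f)` is the extension of
  `f ∘ e⁻¹` at the coordinates of `ξ` (`toHom_eq_weilExtension`, by iterating Hadamard's lemma).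
  Conversely every tuple with real part in the image of `e` is the tuple of coordinates of a point,
  because the extension is multiplicative in `f` (`weilExtension_mul`).  So the charts of `M^A` are
  bijections, and their transition maps are extensions of transition maps of `M`.
* It is smooth, and its derivative in the direction `v ∈ Aⁿ` is `∑ⱼ vⱼ (∂ⱼf)^A`
  (`fderiv_weilExtension`).

A derivation `D` of `C^∞(M)` with components `Dⱼ` in a chart prolongs to the vector field on `M^A`
with components `ξ(Dⱼ)` in the induced chart (`prolongVector`), and `D̃φ` is the derivative of `φ`
along this vector field (`tildeFun`).  The chain rule for `D`, evaluated at `ξ`, together with the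
formula for the derivative of the extension yields at once `D̃(f^A) = (Df)^A` and, applied to the
coordinates of a second chart, the independence of the chart
(`fderiv_chartExpr_prolongVector_eq`).  The vector field is real, so that `D̃` is `A`-linear and
preserves real-valued functions.

For `D = ad(f)` the identity `D̃(g^A) = {f, g}^A` says that prolongation intertwines the adjoint
representation of `C^∞(M)` with the representation on `C^∞(M^A, A)`; the coboundary formula is
natural under such maps (`ceFormula_map`).
-/

noncomputable section

namespace WeilPoisson

/-! ### Augmentation and nilpotency of a Weil algebra -/

section Augmentation

variable (A : Type*) [CommRing A] [Algebra ℝ A] [IsWeilAlgebra A]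

theorem algebraMap_residue_bijective :
    Function.Bijective (algebraMap ℝ (A ⧸ IsLocalRing.maximalIdeal A)) := by
  have : Nontrivial (A ⧸ IsLocalRing.maximalIdeal A) :=
    Ideal.Quotient.nontrivial_iff.2 (IsLocalRing.maximalIdeal.isMaximal A).ne_top
  refine ⟨(algebraMap ℝ _).injective, fun x => ?_⟩
  have h : (⊥ : Subalgebra ℝ (A ⧸ IsLocalRing.maximalIdeal A)) = ⊤ :=
    Subalgebra.bot_eq_top_of_finrank_eq_one IsWeilAlgebra.finrank_residue
  have hx : x ∈ (⊥ : Subalgebra ℝ (A ⧸ IsLocalRing.maximalIdeal A)) := h ▸ Algebra.mem_top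
  exact Algebra.mem_bot.1 hx

/-- The augmentation of a Weil algebra `A`: the homomorphism `A → ℝ` with kernel the maximal
ideal. -/
def augmentation : A →ₐ[ℝ] ℝ :=
  ((AlgEquiv.ofBijective (Algebra.ofId ℝ (A ⧸ IsLocalRing.maximalIdeal A))
    (algebraMap_residue_bijective A)).symm : _ →ₐ[ℝ] ℝ).comp
    (Ideal.Quotient.mkₐ ℝ (IsLocalRing.maximalIdeal A))

variable {A}

theorem augmentation_eq_iff {a : A} {r : ℝ} :
    augmentation A a = r ↔ a - algebraMap ℝ A r ∈ IsLocalRing.maximalIdeal A := by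
  rw [← Ideal.Quotient.eq]
  exact (AlgEquiv.ofBijective (Algebra.ofId ℝ (A ⧸ IsLocalRing.maximalIdeal A))
    (algebraMap_residue_bijective A)).symm_apply_eq

theorem sub_augmentation_mem (a : A) :
    a - algebraMap ℝ A (augmentation A a) ∈ IsLocalRing.maximalIdeal A :=
  augmentation_eq_iff.1 rfl

variable (A) in
theorem exists_maximalIdeal_pow_eq_bot : ∃ N, IsLocalRing.maximalIdeal A ^ N = ⊥ := by
  have : IsArtinianRing A := IsArtinianRing.of_finite ℝ A
  exact (isArtinianRing_iff_isNilpotent_maximalIdeal A).1 this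

variable (A) in
/-- An exponent which annihilates the maximal ideal of the Weil algebra `A`. -/
def nilExponent : ℕ := (exists_maximalIdeal_pow_eq_bot A).choose

variable (A) in
theorem maximalIdeal_pow_nilExponent : IsLocalRing.maximalIdeal A ^ nilExponent A = ⊥ :=
  (exists_maximalIdeal_pow_eq_bot A).choose_spec

end Augmentation

/-! ### Partial derivatives -/

section PartialDeriv

variable {n : ℕ}

/-- The `i`-th partial derivative of a real function on `ℝⁿ`. -/
def pderiv (i : Fin n) (f : EuclideanSpace ℝ (Fin n) → ℝ) (u : EuclideanSpace ℝ (Fin n)) : ℝ :=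
  fderiv ℝ f u (EuclideanSpace.single i 1)

variable {f g : EuclideanSpace ℝ (Fin n) → ℝ} {U : Set (EuclideanSpace ℝ (Fin n))}
  {u : EuclideanSpace ℝ (Fin n)}

theorem fderiv_apply_eq_sum_pderiv (f : EuclideanSpace ℝ (Fin n) → ℝ)
    (u v : EuclideanSpace ℝ (Fin n)) : fderiv ℝ f u v = ∑ i, v i * pderiv i f u := by
  have hv : v = ∑ i, v i • EuclideanSpace.single i (1 : ℝ) := by
    simpa using ((EuclideanSpace.basisFun (Fin n) ℝ).sum_repr v).symm
  conv_lhs => rw [hv]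
  simp [pderiv]

theorem _root_.Filter.EventuallyEq.pderiv (h : f =ᶠ[𝓝 u] g) (i : Fin n) :
    pderiv i f =ᶠ[𝓝 u] pderiv i g :=
  (Filter.EventuallyEq.fderiv h).fun_comp fun L => L (EuclideanSpace.single i 1)

theorem _root_.ContDiffOn.pderiv (hf : ContDiffOn ℝ ∞ f U) (hU : IsOpen U) (i : Fin n) :
    ContDiffOn ℝ ∞ (pderiv i f) U :=
  (hf.fderiv_of_isOpen hU (m := ∞) (by simp)).clm_apply contDiffOn_const

theorem pderiv_comm (hf : ContDiffOn ℝ ∞ f U) (hU : IsOpen U) (hu : u ∈ U) (i j : Fin n) :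
    pderiv i (pderiv j f) u = pderiv j (pderiv i f) u := by
  have hf' := hf.contDiffAt (hU.mem_nhds hu)
  have h1 : DifferentiableAt ℝ (fderiv ℝ f) u :=
    ((hf.fderiv_of_isOpen hU (m := ∞) (by simp)).contDiffAt (hU.mem_nhds hu)).differentiableAt
      (by simp)
  have h2 : ∀ i j, pderiv i (pderiv j f) u =
      fderiv ℝ (fderiv ℝ f) u (EuclideanSpace.single i 1) (EuclideanSpace.single j 1) := by
    intro i j
    change fderiv ℝ (fun y => fderiv ℝ f y (EuclideanSpace.single j 1)) u _ = _
    rw [fderiv_clm_apply h1 (differentiableAt_const _)]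
    simp
  rw [h2, h2]
  exact hf'.isSymmSndFDerivAt (by simpa using ENat.LEInfty.out) _ _

theorem pderiv_add (hf : ContDiffOn ℝ ∞ f U) (hg : ContDiffOn ℝ ∞ g U) (hU : IsOpen U)
    (hu : u ∈ U) (i : Fin n) :
    pderiv i (fun y => f y + g y) u = pderiv i f u + pderiv i g u := by
  have hf' := (hf.contDiffAt (hU.mem_nhds hu)).differentiableAt (by simp)
  have hg' := (hg.contDiffAt (hU.mem_nhds hu)).differentiableAt (by simp)
  simp [pderiv, fderiv_fun_add hf' hg']

theorem pderiv_mul (hf : ContDiffOn ℝ ∞ f U) (hg : ContDiffOn ℝ ∞ g U) (hU : IsOpen U)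
    (hu : u ∈ U) (i : Fin n) :
    pderiv i (fun y => f y * g y) u = pderiv i f u * g u + f u * pderiv i g u := by
  have hf' := (hf.contDiffAt (hU.mem_nhds hu)).differentiableAt (by simp)
  have hg' := (hg.contDiffAt (hU.mem_nhds hu)).differentiableAt (by simp)
  simp [pderiv, fderiv_fun_mul hf' hg']
  ring

theorem pderiv_coord (i j : Fin n) :
    pderiv j (fun y : EuclideanSpace ℝ (Fin n) => y i) = fun _ => if i = j then 1 else 0 := by
  ext u
  have h : HasFDerivAt (fun y : EuclideanSpace ℝ (Fin n) => y i)
    (EuclideanSpace.proj (𝕜 := ℝ) i) u := (EuclideanSpace.proj (𝕜 := ℝ) i).hasFDerivAt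
  simp [pderiv, h.fderiv]

end PartialDeriv

/-! ### Taylor terms with values in an algebra -/

section Taylor

variable {n : ℕ} {A : Type*} [CommRing A] [Algebra ℝ A]

/-- The homogeneous part of degree `k` of the Taylor expansion of `f` at `u`, evaluated at a
tuple `m` of elements of an algebra: `∑_{|α| = k} (∂^α f (u) / α!) m^α`.  It is encoded by
recursion on the degree, through Euler's relation
`(k + 1) s_{k+1}(f) = ∑ᵢ mᵢ s_k(∂ᵢf)`. -/
def taylorTerm : ℕ → (EuclideanSpace ℝ (Fin n) → ℝ) → EuclideanSpace ℝ (Fin n) →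
    (Fin n → A) → A
  | 0, f, u, _ => algebraMap ℝ A (f u)
  | k + 1, f, u, m => ((k : ℝ) + 1)⁻¹ • ∑ i, m i * taylorTerm k (pderiv i f) u m

variable {f g : EuclideanSpace ℝ (Fin n) → ℝ} {U : Set (EuclideanSpace ℝ (Fin n))}
  {u : EuclideanSpace ℝ (Fin n)} {m : Fin n → A}

@[simp]
theorem taylorTerm_zero (f : EuclideanSpace ℝ (Fin n) → ℝ) (u : EuclideanSpace ℝ (Fin n))
    (m : Fin n → A) : taylorTerm 0 f u m = algebraMap ℝ A (f u) := rfl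

theorem taylorTerm_succ (k : ℕ) (f : EuclideanSpace ℝ (Fin n) → ℝ)
    (u : EuclideanSpace ℝ (Fin n)) (m : Fin n → A) :
    taylorTerm (k + 1) f u m =
      ((k : ℝ) + 1)⁻¹ • ∑ i, m i * taylorTerm k (pderiv i f) u m := rfl

theorem smul_taylorTerm_succ (k : ℕ) (f : EuclideanSpace ℝ (Fin n) → ℝ)
    (u : EuclideanSpace ℝ (Fin n)) (m : Fin n → A) :
    ((k : ℝ) + 1) • taylorTerm (k + 1) f u m = ∑ i, m i * taylorTerm k (pderiv i f) u m := by
  have : (k : ℝ) + 1 ≠ 0 := by positivity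
  rw [taylorTerm_succ, smul_inv_smul₀ this]

theorem taylorTerm_congr (h : f =ᶠ[𝓝 u] g) (k : ℕ) (m : Fin n → A) :
    taylorTerm k f u m = taylorTerm k g u m := by
  induction k generalizing f g with
  | zero => simp [h.eq_of_nhds]
  | succ k ih =>
    rw [taylorTerm_succ, taylorTerm_succ]
    simp only [fun i => ih (h.pderiv i)]

theorem taylorTerm_congr_of_eqOn (hU : IsOpen U) (hu : u ∈ U) (h : ∀ y ∈ U, f y = g y) (k : ℕ)
    (m : Fin n → A) : taylorTerm k f u m = taylorTerm k g u m :=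
  taylorTerm_congr (Filter.mem_of_superset (hU.mem_nhds hu) h) k m

theorem taylorTerm_add (hU : IsOpen U) (hu : u ∈ U) (hf : ContDiffOn ℝ ∞ f U)
    (hg : ContDiffOn ℝ ∞ g U) (k : ℕ) (m : Fin n → A) :
    taylorTerm k (fun y => f y + g y) u m = taylorTerm k f u m + taylorTerm k g u m := by
  induction k generalizing f g with
  | zero => simp
  | succ k ih =>
    simp only [taylorTerm_succ, ← smul_add, ← Finset.sum_add_distrib, ← mul_add,
      ← fun i => ih (hf.pderiv hU i) (hg.pderiv hU i)]
    congr! 3 with i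
    exact taylorTerm_congr_of_eqOn hU hu (fun y hy => pderiv_add hf hg hU hy i) k m

theorem taylorTerm_const_succ (c : ℝ) (u : EuclideanSpace ℝ (Fin n)) (k : ℕ) (m : Fin n → A) :
    taylorTerm (k + 1) (fun _ => c) u m = 0 := by
  induction k generalizing c with
  | zero => simp [taylorTerm_succ, pderiv]
  | succ k ih =>
    have : ∀ i : Fin n, pderiv i (fun _ => c) = fun _ => 0 := fun i => by ext; simp [pderiv]
    rw [taylorTerm_succ]
    simp [this, ih]

theorem taylorTerm_coord_one (i : Fin n) (u : EuclideanSpace ℝ (Fin n)) (m : Fin n → A) :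
    taylorTerm 1 (fun y => y i) u m = m i := by
  simp [taylorTerm_succ, pderiv_coord]

theorem taylorTerm_coord_add_two (i : Fin n) (u : EuclideanSpace ℝ (Fin n)) (k : ℕ)
    (m : Fin n → A) : taylorTerm (k + 2) (fun y => y i) u m = 0 := by
  simp [taylorTerm_succ (k + 1), pderiv_coord, taylorTerm_const_succ]

theorem taylorTerm_mem_pow {J : Ideal A} (hm : ∀ i, m i ∈ J) (k : ℕ)
    (f : EuclideanSpace ℝ (Fin n) → ℝ) (u : EuclideanSpace ℝ (Fin n)) :
    taylorTerm k f u m ∈ J ^ k := by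
  induction k generalizing f with
  | zero => simp
  | succ k ih =>
    rw [taylorTerm_succ, Algebra.smul_def]
    refine Ideal.mul_mem_left _ _ (Ideal.sum_mem _ fun i _ => ?_)
    rw [pow_succ']
    exact Ideal.mul_mem_mul (hm i) (ih _)

/-- The Taylor series of `f` at `u` in the direction of `m`, as a formal power series in one
variable. -/
def taylorSeries (f : EuclideanSpace ℝ (Fin n) → ℝ) (u : EuclideanSpace ℝ (Fin n))
    (m : Fin n → A) : PowerSeries A :=
  PowerSeries.mk fun k => taylorTerm k f u m

theorem derivative_taylorSeries (f : EuclideanSpace ℝ (Fin n) → ℝ)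
    (u : EuclideanSpace ℝ (Fin n)) (m : Fin n → A) :
    PowerSeries.derivative A (taylorSeries f u m) =
      ∑ i, m i • taylorSeries (pderiv i f) u m := by
  ext k
  simp only [PowerSeries.coeff_derivative, taylorSeries,
    PowerSeries.coeff_mk, map_sum, PowerSeries.coeff_smul, smul_eq_mul]
  rw [← smul_taylorTerm_succ, Algebra.smul_def]
  simp [mul_comm]

/-- Both sides are determined by their derivatives and constant coefficients, and the derivatives
are combinations of the same kind of series for the partial derivatives of `f` and `g`. -/
theorem taylorSeries_mul (hU : IsOpen U) (hu : u ∈ U) (hf : ContDiffOn ℝ ∞ f U)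
    (hg : ContDiffOn ℝ ∞ g U) (m : Fin n → A) :
    taylorSeries (fun y => f y * g y) u m = taylorSeries f u m * taylorSeries g u m := by
  ext k
  induction k generalizing f g with
  | zero => simp [taylorSeries]
  | succ k ih =>
    have key : PowerSeries.coeff k (PowerSeries.derivative A
          (taylorSeries (fun y => f y * g y) u m)) =
        PowerSeries.coeff k (PowerSeries.derivative A
          (taylorSeries f u m * taylorSeries g u m)) := by
      rw [derivative_taylorSeries, Derivation.leibniz, derivative_taylorSeries,
        derivative_taylorSeries]
      have h : ∀ i, PowerSeries.coeff k (taylorSeries (pderiv i fun y => f y * g y) u m) =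
          PowerSeries.coeff k (taylorSeries (pderiv i f) u m * taylorSeries g u m) +
          PowerSeries.coeff k (taylorSeries f u m * taylorSeries (pderiv i g) u m) := by
        intro i
        rw [← ih (hf.pderiv hU i) hg, ← ih hf (hg.pderiv hU i)]
        simp only [taylorSeries, PowerSeries.coeff_mk]
        rw [taylorTerm_congr_of_eqOn hU hu (fun y hy => pderiv_mul hf hg hU hy i),
          taylorTerm_add hU hu ((hf.pderiv hU i).mul hg) (hf.mul (hg.pderiv hU i))]
      simp only [map_sum, PowerSeries.coeff_smul, h, smul_eq_mul, map_add, Finset.mul_sum,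
        mul_add, Finset.sum_add_distrib, mul_smul_comm]
      rw [add_comm]
      simp only [mul_comm]
    simp only [PowerSeries.coeff_derivative] at key
    have hk : IsUnit ((k : A) + 1) := by
      have : (k : A) + 1 = algebraMap ℝ A ((k : ℝ) + 1) := by simp
      rw [this]
      exact (IsUnit.mk0 ((k : ℝ) + 1) (by positivity)).map _
    exact hk.mul_right_cancel key

end Taylor

/-! ### Derivatives of Taylor terms -/

section TaylorCalculus

variable {n : ℕ} {A : Type*} [NormedCommRing A] [NormedAlgebra ℝ A]
  {f g : EuclideanSpace ℝ (Fin n) → ℝ} {U : Set (EuclideanSpace ℝ (Fin n))}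
  {u : EuclideanSpace ℝ (Fin n)} {m : Fin n → A}

theorem contDiff_algebraMap : ContDiff ℝ ∞ (algebraMap ℝ A) :=
  (algebraMapCLM ℝ A).contDiff

theorem contDiffOn_taylorTerm (hU : IsOpen U) (hf : ContDiffOn ℝ ∞ f U) (k : ℕ) :
    ContDiffOn ℝ ∞ (fun p : EuclideanSpace ℝ (Fin n) × (Fin n → A) => taylorTerm k f p.1 p.2)
      (U ×ˢ Set.univ) := by
  induction k generalizing f with
  | zero =>
    exact contDiff_algebraMap.comp_contDiffOn
      (hf.comp contDiff_fst.contDiffOn fun p hp => hp.1)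
  | succ k ih =>
    simp only [taylorTerm_succ]
    refine (ContDiffOn.sum fun i _ => ?_).const_smul _
    have hi : ContDiff ℝ ∞ fun p : EuclideanSpace ℝ (Fin n) × (Fin n → A) => p.2 i :=
      (contDiff_apply ℝ A i).comp contDiff_snd
    exact hi.contDiffOn.mul (ih (hf.pderiv hU i))

/-- The Taylor term of degree `k - 1`, with the value `0` for `k = 0`. -/
def taylorTermPred : ℕ → (EuclideanSpace ℝ (Fin n) → ℝ) → EuclideanSpace ℝ (Fin n) →
    (Fin n → A) → A
  | 0, _, _, _ => 0
  | k + 1, f, u, m => taylorTerm k f u m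

theorem taylorTermPred_succ (k : ℕ) (f : EuclideanSpace ℝ (Fin n) → ℝ)
    (u : EuclideanSpace ℝ (Fin n)) (m : Fin n → A) :
    taylorTermPred (k + 1) f u m = taylorTerm k f u m := rfl

theorem sum_mul_taylorTermPred (k : ℕ) (f : EuclideanSpace ℝ (Fin n) → ℝ)
    (u : EuclideanSpace ℝ (Fin n)) (m : Fin n → A) :
    ∑ i, m i * taylorTermPred k (pderiv i f) u m = (k : ℝ) • taylorTerm k f u m := by
  cases k with
  | zero => simp [taylorTermPred]
  | succ k =>
    push_cast
    rw [smul_taylorTerm_succ]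
    rfl

theorem taylorTermPred_congr_of_eqOn (hU : IsOpen U) (hu : u ∈ U) (h : ∀ y ∈ U, f y = g y)
    (k : ℕ) (m : Fin n → A) : taylorTermPred k f u m = taylorTermPred k g u m := by
  cases k with
  | zero => rfl
  | succ k => exact taylorTerm_congr_of_eqOn hU hu h k m

/-- Moving the base point by `w` replaces `f` by its derivative along `w`, and moving the argument
by `p` lowers the degree by one.  In the sum over all degrees the two contributions combine into
`∑ⱼ (wⱼ + pⱼ) s(∂ⱼf)`. -/
theorem hasDerivAt_taylorTerm (hU : IsOpen U) (hu : u ∈ U) (hf : ContDiffOn ℝ ∞ f U) (k : ℕ)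
    (m : Fin n → A) (w : EuclideanSpace ℝ (Fin n)) (p : Fin n → A) :
    HasDerivAt (fun t : ℝ => taylorTerm k f (u + t • w) (m + t • p))
      (∑ j, w j • taylorTerm k (pderiv j f) u m +
        ∑ j, p j * taylorTermPred k (pderiv j f) u m) 0 := by
  induction k generalizing f with
  | zero =>
    have hf' : HasFDerivAt f (fderiv ℝ f u) (u + (0 : ℝ) • w) := by
      simpa using ((hf.contDiffAt (hU.mem_nhds hu)).differentiableAt (by simp)).hasFDerivAt
    have h1 : HasDerivAt (fun t : ℝ => u + t • w) w 0 := by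
      simpa using ((hasDerivAt_id (0 : ℝ)).smul_const w).const_add u
    have h2 := (algebraMapCLM ℝ A).hasFDerivAt.comp_hasDerivAt (0 : ℝ)
      (hf'.comp_hasDerivAt (0 : ℝ) h1)
    refine HasDerivAt.congr_deriv h2 ?_
    simp [fderiv_apply_eq_sum_pderiv, taylorTermPred, Algebra.smul_def]
  | succ k ih =>
    have h1 : ∀ i, HasDerivAt (fun t : ℝ => (m + t • p) i) (p i) 0 := fun i => by
      simpa using ((hasDerivAt_id (0 : ℝ)).smul_const (p i)).const_add (m i)
    have h2 := (HasDerivAt.fun_sum (u := Finset.univ)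
      fun i _ => (h1 i).mul (ih (hf.pderiv hU i))).const_smul ((k : ℝ) + 1)⁻¹
    have h0 : (k : ℝ) + 1 ≠ 0 := by positivity
    refine HasDerivAt.congr_deriv h2 ?_
    simp only [Finset.sum_add_distrib, mul_add, zero_smul, add_zero, taylorTermPred_succ]
    have e1 : ∑ i, m i * ∑ j, w j • taylorTerm k (pderiv j (pderiv i f)) u m =
        ((k : ℝ) + 1) • ∑ j, w j • taylorTerm (k + 1) (pderiv j f) u m := by
      simp only [Finset.smul_sum, smul_comm ((k : ℝ) + 1), smul_taylorTerm_succ, Finset.mul_sum,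
        mul_smul_comm]
      rw [Finset.sum_comm]
      refine Finset.sum_congr rfl fun j _ => Finset.sum_congr rfl fun i _ => ?_
      rw [taylorTerm_congr_of_eqOn hU hu fun y hy => pderiv_comm hf hU hy j i]
    have e2 : ∑ i, m i * ∑ j, p j * taylorTermPred k (pderiv j (pderiv i f)) u m =
        (k : ℝ) • ∑ j, p j * taylorTerm k (pderiv j f) u m := by
      simp only [Finset.smul_sum, ← mul_smul_comm, ← sum_mul_taylorTermPred, Finset.mul_sum]
      rw [Finset.sum_comm]
      refine Finset.sum_congr rfl fun j _ => Finset.sum_congr rfl fun i _ => ?_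
      rw [taylorTermPred_congr_of_eqOn hU hu fun y hy => pderiv_comm hf hU hy j i]
      ring
    rw [e1, e2, inv_smul_eq_iff₀ h0, smul_add, add_smul _ _ (∑ j, p j * _), one_smul]
    abel

end TaylorCalculus

/-! ### The extension of smooth functions to a Weil algebra -/

section WeilExtension

variable {n : ℕ} {A : Type*} [NormedCommRing A] [NormedAlgebra ℝ A] [IsWeilAlgebra A]

/-- The real part of a tuple `a ∈ Aⁿ`, a point of `ℝⁿ`. -/
def realPart (a : Fin n → A) : EuclideanSpace ℝ (Fin n) :=
  WithLp.toLp 2 fun i => augmentation A (a i)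

/-- The nilpotent part of a tuple `a ∈ Aⁿ`. -/
def nilPart (a : Fin n → A) : Fin n → A := fun i => a i - algebraMap ℝ A (realPart a i)

/-- The extension of a function `f` on (an open subset of) `ℝⁿ` to tuples in `Aⁿ`, by its Taylor
expansion at the real part of the tuple; the expansion is finite since the nilpotent part has
entries in the maximal ideal. -/
def weilExtension (f : EuclideanSpace ℝ (Fin n) → ℝ) (a : Fin n → A) : A :=
  ∑ k ∈ Finset.range (nilExponent A), taylorTerm k f (realPart a) (nilPart a)

variable {f g : EuclideanSpace ℝ (Fin n) → ℝ} {U : Set (EuclideanSpace ℝ (Fin n))}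
  {a : Fin n → A}

theorem nilPart_mem (a : Fin n → A) (i : Fin n) : nilPart a i ∈ IsLocalRing.maximalIdeal A :=
  sub_augmentation_mem (a i)

theorem realPart_eq_iff {u : EuclideanSpace ℝ (Fin n)} :
    realPart a = u ↔ ∀ i, a i - algebraMap ℝ A (u i) ∈ IsLocalRing.maximalIdeal A := by
  simp only [← augmentation_eq_iff]
  exact ⟨fun h i => by simp [← h, realPart], fun h => by ext i; exact h i⟩

variable (n A) in
/-- The real part as a continuous linear map. -/
def realPartCLM : (Fin n → A) →L[ℝ] EuclideanSpace ℝ (Fin n) :=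
  LinearMap.toContinuousLinearMap
    { toFun := realPart
      map_add' := fun a b => by ext; simp [realPart]
      map_smul' := fun c a => by ext; simp [realPart] }

variable (n A) in
/-- The nilpotent part as a continuous linear map. -/
def nilPartCLM : (Fin n → A) →L[ℝ] (Fin n → A) :=
  LinearMap.toContinuousLinearMap
    { toFun := nilPart
      map_add' := fun a b => by ext; simp [nilPart, realPart]; ring
      map_smul' := fun c a => by ext; simp [nilPart, realPart, Algebra.smul_def]; ring }

@[simp] theorem realPartCLM_apply (a : Fin n → A) : realPartCLM n A a = realPart a := rfl

@[simp] theorem nilPartCLM_apply (a : Fin n → A) : nilPartCLM n A a = nilPart a := rfl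

theorem algebraMap_realPart_add_nilPart (a : Fin n → A) (i : Fin n) :
    algebraMap ℝ A (realPart a i) + nilPart a i = a i := add_sub_cancel _ _

theorem taylorTerm_nilPart_eq_zero {k : ℕ} (hk : nilExponent A ≤ k)
    (f : EuclideanSpace ℝ (Fin n) → ℝ) (u : EuclideanSpace ℝ (Fin n)) (a : Fin n → A) :
    taylorTerm k f u (nilPart a) = 0 := by
  have h := Ideal.pow_le_pow_right hk (taylorTerm_mem_pow (nilPart_mem a) k f u)
  rwa [maximalIdeal_pow_nilExponent, Ideal.mem_bot] at h

theorem weilExtension_eq_sum {K : ℕ} (hK : nilExponent A ≤ K)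
    (f : EuclideanSpace ℝ (Fin n) → ℝ) (a : Fin n → A) :
    weilExtension f a = ∑ k ∈ Finset.range K, taylorTerm k f (realPart a) (nilPart a) := by
  refine Finset.sum_subset (Finset.range_mono hK) fun k _ hk => ?_
  exact taylorTerm_nilPart_eq_zero (by simpa using hk) _ _ _

theorem weilExtension_congr (h : f =ᶠ[𝓝 (realPart a)] g) :
    weilExtension f a = weilExtension g a :=
  Finset.sum_congr rfl fun k _ => taylorTerm_congr h k _

theorem weilExtension_const (c : ℝ) (a : Fin n → A) :
    weilExtension (fun _ => c) a = algebraMap ℝ A c := by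
  rw [weilExtension_eq_sum (Nat.le_succ _), Finset.sum_range_succ']
  simp [taylorTerm_const_succ]

theorem weilExtension_coord (i : Fin n) (a : Fin n → A) :
    weilExtension (fun y => y i) a = a i := by
  rw [weilExtension_eq_sum (Nat.le_add_right _ 2), Finset.sum_range_succ',
    Finset.sum_range_succ']
  conv_rhs => rw [← algebraMap_realPart_add_nilPart a i]
  simp only [taylorTerm_coord_add_two, Finset.sum_const_zero, zero_add, taylorTerm_coord_one,
    taylorTerm_zero]
  exact add_comm _ _

theorem weilExtension_add (hU : IsOpen U) (ha : realPart a ∈ U) (hf : ContDiffOn ℝ ∞ f U)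
    (hg : ContDiffOn ℝ ∞ g U) :
    weilExtension (fun y => f y + g y) a = weilExtension f a + weilExtension g a := by
  simp only [weilExtension, ← Finset.sum_add_distrib, taylorTerm_add hU ha hf hg]

theorem weilExtension_sub_mem (f : EuclideanSpace ℝ (Fin n) → ℝ) (a : Fin n → A) :
    weilExtension f a - algebraMap ℝ A (f (realPart a)) ∈ IsLocalRing.maximalIdeal A := by
  rw [weilExtension_eq_sum (Nat.le_succ _), Finset.sum_range_succ', taylorTerm_zero,
    add_sub_cancel_right]
  exact Ideal.sum_mem _ fun k _ => Ideal.pow_le_self k.succ_ne_zero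
    (taylorTerm_mem_pow (nilPart_mem a) _ _ _)

theorem weilExtension_mul (hU : IsOpen U) (ha : realPart a ∈ U) (hf : ContDiffOn ℝ ∞ f U)
    (hg : ContDiffOn ℝ ∞ g U) :
    weilExtension (fun y => f y * g y) a = weilExtension f a * weilExtension g a := by
  -- the Taylor series are polynomials, and the extension is their value at `1`
  let T (h : EuclideanSpace ℝ (Fin n) → ℝ) : Polynomial A :=
    (taylorSeries h (realPart a) (nilPart a)).trunc (nilExponent A)
  have hT : ∀ h, (T h : PowerSeries A) = taylorSeries h (realPart a) (nilPart a) := fun h => by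
    ext k
    rw [Polynomial.coeff_coe, PowerSeries.coeff_trunc]
    split_ifs with hk
    · rfl
    · rw [taylorSeries, PowerSeries.coeff_mk, taylorTerm_nilPart_eq_zero (not_lt.1 hk)]
  have hE : ∀ h, weilExtension h a = (T h).eval 1 := fun h => by
    rw [Polynomial.eval, PowerSeries.eval₂_trunc_eq_sum_range]
    simp [taylorSeries, weilExtension]
  rw [hE, hE, hE, ← Polynomial.eval_mul]
  congr 1
  apply Polynomial.coe_injective
  rw [Polynomial.coe_mul, hT, hT, hT, taylorSeries_mul hU ha hf hg]

theorem contDiffOn_weilExtension (hU : IsOpen U) (hf : ContDiffOn ℝ ∞ f U) :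
    ContDiffOn ℝ ∞ (weilExtension f) {a : Fin n → A | realPart a ∈ U} := by
  refine ContDiffOn.sum fun k _ => ?_
  exact (contDiffOn_taylorTerm hU hf k).comp
    ((realPartCLM n A).contDiff.prodMk (nilPartCLM n A).contDiff).contDiffOn
    fun a ha => ⟨ha, trivial⟩

theorem isOpen_setOf_realPart_mem (hU : IsOpen U) : IsOpen {a : Fin n → A | realPart a ∈ U} :=
  hU.preimage (realPartCLM n A).continuous

/-- The derivative of the extension is the `A`-linear map with coefficients the extensions of the
partial derivatives. -/
theorem fderiv_weilExtension (hU : IsOpen U) (ha : realPart a ∈ U) (hf : ContDiffOn ℝ ∞ f U)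
    (v : Fin n → A) :
    fderiv ℝ (weilExtension f) a v = ∑ j, v j * weilExtension (pderiv j f) a := by
  have hd : DifferentiableAt ℝ (weilExtension f) a :=
    ((contDiffOn_weilExtension hU hf).contDiffAt
      ((isOpen_setOf_realPart_mem hU).mem_nhds ha)).differentiableAt (by simp)
  have h1 : HasDerivAt (fun t : ℝ => a + t • v) v 0 := by
    simpa using ((hasDerivAt_id (0 : ℝ)).smul_const v).const_add a
  have h2 : HasFDerivAt (weilExtension f) (fderiv ℝ (weilExtension f) a) (a + (0 : ℝ) • v) := by
    simpa using hd.hasFDerivAt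
  have h3 := h2.comp_hasDerivAt (0 : ℝ) h1
  have h4 := HasDerivAt.fun_sum (u := Finset.range (nilExponent A + 1)) fun k _ =>
    hasDerivAt_taylorTerm hU ha hf k (nilPart a) (realPart v) (nilPart v)
  have h5 : (fun t : ℝ => ∑ k ∈ Finset.range (nilExponent A + 1),
      taylorTerm k f (realPart a + t • realPart v) (nilPart a + t • nilPart v)) =
      weilExtension f ∘ fun t => a + t • v := by
    ext t
    have e1 := (realPartCLM n A).map_add a (t • v)
    have e2 := (nilPartCLM n A).map_add a (t • v)
    rw [map_smul] at e1 e2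
    simp only [realPartCLM_apply, nilPartCLM_apply] at e1 e2
    rw [Function.comp_apply, weilExtension_eq_sum (Nat.le_succ _), e1, e2]
  rw [h5] at h4
  rw [h3.unique h4, Finset.sum_add_distrib, Finset.sum_comm,
    Finset.sum_comm (f := fun k j => nilPart v j * _), ← Finset.sum_add_distrib]
  refine Finset.sum_congr rfl fun j _ => ?_
  rw [← Finset.smul_sum, ← Finset.mul_sum, ← weilExtension_eq_sum (Nat.le_succ _),
    Finset.sum_range_succ']
  simp only [taylorTermPred, add_zero]
  rw [← algebraMap_realPart_add_nilPart v j, add_mul, Algebra.smul_def]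
  rfl

end WeilExtension

/-! ### Hadamard's lemma -/

section Hadamard

/-- The mean `∫₀¹ t^c h(u + t(y - u)) dt` of a function `h` along the segment from `u` to `y`,
with weight `t^c`. -/
def segmentMean {E G : Type*} [NormedAddCommGroup E] [NormedSpace ℝ E] [NormedAddCommGroup G]
    [NormedSpace ℝ G] (c : ℕ) (u : E) (h : E → G) (y : E) : G :=
  ∫ t in (0 : ℝ)..1, t ^ c • h (u + t • (y - u))

section General

universe v

variable {E : Type v} [NormedAddCommGroup E] [NormedSpace ℝ E]

theorem continuous_segmentMean {G : Type*} [NormedAddCommGroup G] [NormedSpace ℝ G]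
    {h : E → G} (hh : Continuous h) (c : ℕ) (u : E) : Continuous (segmentMean c u h) :=
  intervalIntegral.continuous_parametric_intervalIntegral_of_continuous' (by fun_prop) 0 1

theorem hasFDerivAt_segmentMean [FiniteDimensional ℝ E] {G : Type*} [NormedAddCommGroup G]
    [NormedSpace ℝ G] {h : E → G} (hh : ContDiff ℝ 1 h) (c : ℕ) (u y : E) :
    HasFDerivAt (segmentMean c u h) (segmentMean (c + 1) u (fderiv ℝ h) y) y := by
  have hc : Continuous h := hh.continuous
  have hc' : Continuous (fderiv ℝ h) := hh.continuous_fderiv (by simp)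
  have hK : IsCompact ((fun p : E × ℝ => p.2 ^ (c + 1) • fderiv ℝ h (u + p.2 • (p.1 - u))) ''
      (Metric.closedBall y 1 ×ˢ Set.Icc 0 1)) :=
    ((isCompact_closedBall y 1).prod isCompact_Icc).image (by fun_prop)
  obtain ⟨C, hC⟩ := hK.isBounded.exists_norm_le
  refine intervalIntegral.hasFDerivAt_integral_of_dominated_of_fderiv_le
    (F' := fun y t => t ^ (c + 1) • fderiv ℝ h (u + t • (y - u)))
    (bound := fun _ => C) (Metric.closedBall_mem_nhds y one_pos) ?_ ?_ ?_ ?_ ?_ ?_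
  · exact Filter.Eventually.of_forall fun y => Continuous.aestronglyMeasurable (by fun_prop)
  · exact Continuous.intervalIntegrable (by fun_prop) _ _
  · exact Continuous.aestronglyMeasurable (by fun_prop)
  · refine Filter.Eventually.of_forall fun t ht x hx => hC _ ⟨(x, t), ⟨hx, ?_⟩, rfl⟩
    rw [Set.uIoc_of_le zero_le_one] at ht
    exact ⟨ht.1.le, ht.2⟩
  · exact intervalIntegrable_const
  · refine Filter.Eventually.of_forall fun t _ x _ => ?_
    have h1 : HasFDerivAt (fun x : E => u + t • (x - u)) (t • ContinuousLinearMap.id ℝ E) x :=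
      (((hasFDerivAt_id x).sub_const u).const_smul t).const_add u
    have h2 := (((hh.differentiable (by simp)) (u + t • (x - u))).hasFDerivAt.comp x h1).const_smul
      (t ^ c)
    refine h2.congr_fderiv ?_
    ext v
    simp [pow_succ, smul_smul]

theorem contDiff_segmentMean [FiniteDimensional ℝ E] {G : Type v} [NormedAddCommGroup G]
    [NormedSpace ℝ G] {h : E → G} (hh : ContDiff ℝ ∞ h) (c : ℕ) (u : E) : ContDiff ℝ ∞ (segmentMean c u h) := by
  refine contDiff_infty.2 fun k => ?_
  induction k generalizing G c with
  | zero => exact contDiff_zero.2 (continuous_segmentMean hh.continuous c u)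
  | succ k ih =>
    exact contDiff_succ_iff_hasFDerivAt.2 ⟨_, ih (hh.fderiv_right (by simp)) (c + 1),
      hasFDerivAt_segmentMean (hh.of_le (by simp)) c u⟩

theorem segmentMean_self (c : ℕ) (u : E) (h : E → ℝ) :
    segmentMean c u h u = ((c : ℝ) + 1)⁻¹ * h u := by
  simp [segmentMean]

end General

variable {n : ℕ} {h : EuclideanSpace ℝ (Fin n) → ℝ}

theorem pderiv_segmentMean (hh : ContDiff ℝ ∞ h) (c : ℕ) (u : EuclideanSpace ℝ (Fin n))
    (i : Fin n) : pderiv i (segmentMean c u h) = segmentMean (c + 1) u (pderiv i h) := by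
  ext y
  have hc : Continuous (fderiv ℝ h) := hh.continuous_fderiv (by simp)
  rw [pderiv, (hasFDerivAt_segmentMean (hh.of_le (by simp)) c u y).fderiv, segmentMean,
    ContinuousLinearMap.intervalIntegral_apply (Continuous.intervalIntegrable (by fun_prop) _ _)]
  rfl

theorem _root_.ContDiff.pderiv (hh : ContDiff ℝ ∞ h) (i : Fin n) : ContDiff ℝ ∞ (pderiv i h) :=
  contDiffOn_univ.1 (hh.contDiffOn.pderiv isOpen_univ i)

/-- Each partial derivative raises the weight of the mean by one, so the mean of weight `t^c` has
at the base point the Taylor terms of `h` multiplied by `∫₀¹ t^(c+k) dt`. -/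
theorem taylorTerm_segmentMean {A : Type*} [CommRing A] [Algebra ℝ A] (hh : ContDiff ℝ ∞ h)
    (k c : ℕ) (u : EuclideanSpace ℝ (Fin n)) (m : Fin n → A) :
    taylorTerm k (segmentMean c u h) u m = ((c : ℝ) + k + 1)⁻¹ • taylorTerm k h u m := by
  induction k generalizing c h with
  | zero => simp [segmentMean_self, Algebra.smul_def]
  | succ k ih =>
    simp only [taylorTerm_succ, pderiv_segmentMean hh, fun i => ih (hh.pderiv i) (c + 1),
      mul_smul_comm, ← Finset.smul_sum]
    rw [smul_comm]
    congr 3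
    push_cast
    ring

theorem taylorTerm_succ_eq_sum_segmentMean {A : Type*} [CommRing A] [Algebra ℝ A]
    (hh : ContDiff ℝ ∞ h) (k : ℕ) (u : EuclideanSpace ℝ (Fin n)) (m : Fin n → A) :
    taylorTerm (k + 1) h u m =
      ∑ i, m i * taylorTerm k (segmentMean 0 u (pderiv i h)) u m := by
  simp only [taylorTerm_succ, fun i => taylorTerm_segmentMean (hh.pderiv i) k 0 u m, mul_smul_comm,
    ← Finset.smul_sum, Nat.cast_zero, zero_add]

/-- **Hadamard's lemma**. -/
theorem eq_add_sum_mul_segmentMean (hh : ContDiff ℝ ∞ h) (u y : EuclideanSpace ℝ (Fin n)) :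
    h y = h u + ∑ i, (y i - u i) * segmentMean 0 u (pderiv i h) y := by
  have hc : ∀ i, Continuous (pderiv i h) := fun i => (hh.pderiv i).continuous
  have h1 : ∀ t : ℝ, HasDerivAt (fun t : ℝ => h (u + t • (y - u)))
      (∑ i, (y i - u i) * pderiv i h (u + t • (y - u))) t := fun t => by
    have h2 : HasDerivAt (fun t : ℝ => u + t • (y - u)) (y - u) t := by
      simpa using ((hasDerivAt_id t).smul_const (y - u)).const_add u
    have h3 := ((hh.differentiable (by simp)) (u + t • (y - u))).hasFDerivAt.comp_hasDerivAt t h2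
    refine h3.congr_deriv ?_
    simp [fderiv_apply_eq_sum_pderiv]
  have h4 := intervalIntegral.integral_eq_sub_of_hasDerivAt (a := 0) (b := 1) (fun t _ => h1 t)
    (Continuous.intervalIntegrable (by fun_prop) _ _)
  rw [intervalIntegral.integral_finsetSum
    fun i _ => Continuous.intervalIntegrable (by fun_prop) _ _] at h4
  simp only [one_smul, add_sub_cancel, zero_smul, add_zero,
    intervalIntegral.integral_const_mul] at h4
  simp [segmentMean, h4]

end Hadamard

/-! ### Germs of smooth functions on a manifold -/

section Germs

variable {n : ℕ} {M : Type*} [TopologicalSpace M]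
  [ChartedSpace (EuclideanSpace ℝ (Fin n)) M]

/-- Evaluation at a point as an algebra homomorphism. -/
def evalAt (x : M) : SmoothFn n M →ₐ[ℝ] ℝ :=
  (Pi.evalAlgHom ℝ (fun _ : M => ℝ) x).comp ContMDiffMap.coeFnAlgHom

theorem evalAt_apply (x : M) (f : SmoothFn n M) : evalAt x f = f x := rfl

theorem exists_contDiff_germ {f : EuclideanSpace ℝ (Fin n) → ℝ}
    {U : Set (EuclideanSpace ℝ (Fin n))} (hU : IsOpen U) {u : EuclideanSpace ℝ (Fin n)}
    (hu : u ∈ U) (hf : ContDiffOn ℝ ∞ f U) :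
    ∃ h : EuclideanSpace ℝ (Fin n) → ℝ, ContDiff ℝ ∞ h ∧ h =ᶠ[𝓝 u] f := by
  obtain ⟨b, -, hb⟩ :=
    (SmoothBumpFunction.nhds_basis_tsupport (I := 𝓡 n) u).mem_iff.1 (hU.mem_nhds hu)
  refine ⟨fun y => b y * f y, contDiff_iff_contDiffAt.2 fun y => ?_, ?_⟩
  · by_cases hy : y ∈ tsupport b
    · exact b.contMDiff.contDiff.contDiffAt.mul (hf.contDiffAt (hU.mem_nhds (hb hy)))
    · refine (contDiffAt_const (c := (0 : ℝ))).congr_of_eventuallyEq ?_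
      filter_upwards [notMem_tsupport_iff_eventuallyEq.1 hy] with z hz
      simp [hz]
  · filter_upwards [b.eventuallyEq_one] with y hy
    simp [hy]

variable {e : OpenPartialHomeomorph M (EuclideanSpace ℝ (Fin n))} {x : M}

theorem contDiffOn_comp_symm (he : e ∈ IsManifold.maximalAtlas (𝓡 n) ∞ M) (f : SmoothFn n M) :
    ContDiffOn ℝ ∞ (f ∘ e.symm) e.target :=
  (f.contMDiff.comp_contMDiffOn (contMDiffOn_symm_of_mem_maximalAtlas he)).contDiffOn

variable [T2Space M] [IsManifold (𝓡 n) ∞ M]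

theorem exists_smoothFn_germ (he : e ∈ IsManifold.maximalAtlas (𝓡 n) ∞ M) (hx : x ∈ e.source)
    {h : EuclideanSpace ℝ (Fin n) → ℝ} (hh : ContDiff ℝ ∞ h) :
    ∃ g : SmoothFn n M, g =ᶠ[𝓝 x] h ∘ e := by
  obtain ⟨b, -, hb⟩ := (SmoothBumpFunction.nhds_basis_tsupport (I := 𝓡 n) x).mem_iff.1
    (e.open_source.mem_nhds hx)
  refine ⟨⟨fun y => b y * h (e y), fun y => ?_⟩, ?_⟩
  · by_cases hy : y ∈ tsupport b
    · have h1 : ContMDiffAt (𝓡 n) 𝓘(ℝ, ℝ) ∞ (h ∘ e) y :=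
        hh.contMDiff.contMDiffAt.comp y ((contMDiffOn_of_mem_maximalAtlas he).contMDiffAt
          (e.open_source.mem_nhds (hb hy)))
      exact b.contMDiff.contMDiffAt.mul h1
    · refine (contMDiffAt_const (c := (0 : ℝ))).congr_of_eventuallyEq ?_
      filter_upwards [notMem_tsupport_iff_eventuallyEq.1 hy] with z hz
      simp [hz]
  · filter_upwards [b.eventuallyEq_one] with y hy
    change b y * h (e y) = h (e y)
    simp [hy]

theorem exists_smoothFn_coord (he : e ∈ IsManifold.maximalAtlas (𝓡 n) ∞ M) (hx : x ∈ e.source)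
    (i : Fin n) : ∃ g : SmoothFn n M, g =ᶠ[𝓝 x] fun y => e y i :=
  exists_smoothFn_germ he hx (EuclideanSpace.proj (𝕜 := ℝ) i).contDiff

/-- Hadamard's lemma on a manifold: near `x`, a smooth function differs from a constant by a
combination of the coordinate functions centred at `x`, with globally defined coefficients. -/
theorem exists_hadamard (he : e ∈ IsManifold.maximalAtlas (𝓡 n) ∞ M) (hx : x ∈ e.source)
    {X : Fin n → SmoothFn n M} (hX : ∀ i, X i =ᶠ[𝓝 x] fun y => e y i)
    {h : EuclideanSpace ℝ (Fin n) → ℝ} (hh : ContDiff ℝ ∞ h) {f : SmoothFn n M}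
    (hf : f =ᶠ[𝓝 x] h ∘ e) :
    ∃ g : Fin n → SmoothFn n M,
      (∀ i, g i =ᶠ[𝓝 x] segmentMean 0 (e x) (pderiv i h) ∘ e) ∧
      f =ᶠ[𝓝 x] (algebraMap ℝ (SmoothFn n M) (h (e x)) +
        ∑ i, (X i - algebraMap ℝ (SmoothFn n M) (e x i)) * g i : SmoothFn n M) := by
  choose g hg using fun i =>
    exists_smoothFn_germ he hx (contDiff_segmentMean (hh.pderiv i) 0 (e x))
  refine ⟨g, hg, ?_⟩
  filter_upwards [hf, Filter.eventually_all.2 hg, Filter.eventually_all.2 hX] with y h1 h2 h3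
  rw [h1, Function.comp_apply, eq_add_sum_mul_segmentMean hh (e x) (e y)]
  change _ = evalAt y (_ + _)
  simp only [map_add, map_sum, map_mul, map_sub, AlgHom.commutes, evalAt_apply, h2, h3]
  rfl

/-! ### Derivations of the algebra of smooth functions -/

variable (D : Derivation ℝ (SmoothFn n M) (SmoothFn n M))

theorem derivation_apply_eq_zero_of_germ {f : SmoothFn n M} (hf : f =ᶠ[𝓝 x] 0) : D f x = 0 := by
  obtain ⟨b, -, hb⟩ := (SmoothBumpFunction.nhds_basis_support (I := 𝓡 n) hf).mem_iff.1 hf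
  let χ : SmoothFn n M := ⟨b, b.contMDiff⟩
  have h0 : χ * f = 0 := by
    ext y
    by_cases hy : y ∈ Function.support b
    · have : f y = 0 := hb hy
      simp [this]
    · have : b y = 0 := by simpa using hy
      change b y * _ = 0
      rw [this, zero_mul]
  have h1 : χ x = 1 := b.eq_one
  have h2 := congrArg (evalAt x) (D.leibniz χ f)
  rw [h0, map_zero, map_zero, map_add] at h2
  simp only [smul_eq_mul, map_mul, evalAt_apply, h1, hf.eq_of_nhds] at h2
  simpa using h2.symm

theorem derivation_congr_germ {f g : SmoothFn n M} (hfg : f =ᶠ[𝓝 x] g) : D f =ᶠ[𝓝 x] D g := by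
  filter_upwards [hfg.eventually_nhds] with y hy
  have h : D (f - g) y = 0 := derivation_apply_eq_zero_of_germ D <| by
    filter_upwards [hy] with z hz
    have : (f - g) z = f z - g z := rfl
    simp [this, hz]
  rw [map_sub] at h
  exact sub_eq_zero.1 h

theorem derivation_apply_eq_sum (he : e ∈ IsManifold.maximalAtlas (𝓡 n) ∞ M)
    (hx : x ∈ e.source) {X : Fin n → SmoothFn n M} (hX : ∀ i, X i =ᶠ[𝓝 x] fun y => e y i)
    (f : SmoothFn n M) : D f x = ∑ i, pderiv i (f ∘ e.symm) (e x) * D (X i) x := by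
  obtain ⟨h, hh, hfh⟩ := exists_contDiff_germ e.open_target (e.map_source hx)
    (contDiffOn_comp_symm he f)
  have hf : f =ᶠ[𝓝 x] h ∘ e := by
    filter_upwards [(e.continuousAt hx).eventually hfh, e.open_source.mem_nhds hx] with y h1 h2
    simp [h1, e.left_inv h2]
  obtain ⟨g, hg, hfg⟩ := exists_hadamard he hx hX hh hf
  have h1 := (derivation_congr_germ D hfg).eq_of_nhds
  rw [h1, ← evalAt_apply, map_add, map_sum]
  simp only [D.map_algebraMap, D.leibniz, map_add, map_sub, map_sum, smul_eq_mul, map_mul,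
    evalAt_apply, (hX _).eq_of_nhds, (hg _).eq_of_nhds, AlgHom.commutes]
  simp [segmentMean_self, (hfh.pderiv _).eq_of_nhds]

end Germs

/-! ### Infinitely near points in a chart -/

section Points

variable {n : ℕ} {M : Type*} [TopologicalSpace M]
  [ChartedSpace (EuclideanSpace ℝ (Fin n)) M] [T2Space M] [IsManifold (𝓡 n) ∞ M]
  {A : Type*} [NormedCommRing A] [NormedAlgebra ℝ A] [IsWeilAlgebra A]
  {e : OpenPartialHomeomorph M (EuclideanSpace ℝ (Fin n))} {ξ : WeilBundle n M A}

theorem weilChart_apply {i : Fin n} {g : SmoothFn n M} (hg : g =ᶠ[𝓝 ξ.origin] fun y => e y i) :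
    weilChart e ξ i = ξ.toHom g := evalGerm_eq ξ hg

theorem realPart_weilChart (he : e ∈ IsManifold.maximalAtlas (𝓡 n) ∞ M)
    (hξ : ξ.origin ∈ e.source) : realPart (weilChart e ξ) = e ξ.origin := by
  refine realPart_eq_iff.2 fun i => ?_
  obtain ⟨g, hg⟩ := exists_smoothFn_coord he hξ i
  rw [weilChart_apply hg, ← show g ξ.origin = _ from hg.eq_of_nhds]
  exact ξ.sub_mem g

/-- The value of an infinitely near point at a smooth function agrees with the Taylor expansion
up to order `k`.  The induction on `k` applies Hadamard's lemma; the Taylor terms of its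
coefficients are those of the function itself, one degree up. -/
theorem toHom_sub_sum_taylorTerm_mem (he : e ∈ IsManifold.maximalAtlas (𝓡 n) ∞ M)
    (hξ : ξ.origin ∈ e.source) (k : ℕ) {h : EuclideanSpace ℝ (Fin n) → ℝ} (hh : ContDiff ℝ ∞ h)
    {f : SmoothFn n M} (hf : f =ᶠ[𝓝 ξ.origin] h ∘ e) :
    ξ.toHom f - ∑ j ∈ Finset.range k, taylorTerm j h (e ξ.origin) (nilPart (weilChart e ξ)) ∈
      IsLocalRing.maximalIdeal A ^ k := by
  induction k generalizing h f with
  | zero => simp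
  | succ k ih =>
    choose X hX using exists_smoothFn_coord he hξ
    obtain ⟨g, hg, hfg⟩ := exists_hadamard he hξ hX hh hf
    have hm : ∀ i, ξ.toHom (X i) - algebraMap ℝ A (e ξ.origin i) = nilPart (weilChart e ξ) i :=
      fun i => by rw [nilPart, realPart_weilChart he hξ, weilChart_apply (hX i)]
    have h1 : ξ.toHom f - ∑ j ∈ Finset.range (k + 1),
          taylorTerm j h (e ξ.origin) (nilPart (weilChart e ξ)) =
        ∑ i, nilPart (weilChart e ξ) i * (ξ.toHom (g i) - ∑ j ∈ Finset.range k,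
          taylorTerm j (segmentMean 0 (e ξ.origin) (pderiv i h)) (e ξ.origin)
            (nilPart (weilChart e ξ))) := by
      rw [ξ.congr_germ hfg, Finset.sum_range_succ']
      simp only [map_add, map_sum, map_mul, map_sub, AlgHom.commutes, hm, taylorTerm_zero,
        taylorTerm_succ_eq_sum_segmentMean hh, mul_sub, Finset.sum_sub_distrib, Finset.mul_sum]
      rw [Finset.sum_comm]
      ring
    rw [h1]
    refine Ideal.sum_mem _ fun i _ => ?_
    rw [pow_succ']
    exact Ideal.mul_mem_mul (nilPart_mem _ i)
      (ih (contDiff_segmentMean (hh.pderiv i) 0 (e ξ.origin)) (hg i))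

/-- An infinitely near point is determined by its coordinates: its value at `f` is the extension
to `Aⁿ` of the local expression of `f`. -/
theorem toHom_eq_weilExtension (he : e ∈ IsManifold.maximalAtlas (𝓡 n) ∞ M)
    (hξ : ξ.origin ∈ e.source) (f : SmoothFn n M) :
    ξ.toHom f = weilExtension (f ∘ e.symm) (weilChart e ξ) := by
  obtain ⟨h, hh, hfh⟩ := exists_contDiff_germ e.open_target (e.map_source hξ)
    (contDiffOn_comp_symm he f)
  have hf : f =ᶠ[𝓝 ξ.origin] h ∘ e := by
    filter_upwards [(e.continuousAt hξ).eventually hfh, e.open_source.mem_nhds hξ] with y h1 h2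
    simp [h1, e.left_inv h2]
  have h1 := toHom_sub_sum_taylorTerm_mem he hξ (nilExponent A) hh hf
  rw [maximalIdeal_pow_nilExponent, Ideal.mem_bot, sub_eq_zero, ← realPart_weilChart he hξ] at h1
  rw [h1]
  rw [← realPart_weilChart he hξ] at hfh
  exact weilExtension_congr hfh

theorem toHom_eq_weilExtension_of_germ (he : e ∈ IsManifold.maximalAtlas (𝓡 n) ∞ M)
    (hξ : ξ.origin ∈ e.source) {f : SmoothFn n M} {h : EuclideanSpace ℝ (Fin n) → ℝ}
    (hf : f =ᶠ[𝓝 ξ.origin] h ∘ e) : ξ.toHom f = weilExtension h (weilChart e ξ) := by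
  rw [toHom_eq_weilExtension he hξ]
  refine weilExtension_congr ?_
  rw [realPart_weilChart he hξ]
  have h1 : Filter.Tendsto e.symm (𝓝 (e ξ.origin)) (𝓝 ξ.origin) := by
    simpa [e.left_inv hξ] using (e.continuousAt_symm (e.map_source hξ)).tendsto
  filter_upwards [h1.eventually hf, e.open_target.mem_nhds (e.map_source hξ)] with u h2 h3
  simp [h2, e.right_inv h3]

/-- A derivation of `C^∞(M)`, evaluated at an infinitely near point, is given by the chain rule
from its values on coordinate functions. -/
theorem toHom_derivation_eq_sum (he : e ∈ IsManifold.maximalAtlas (𝓡 n) ∞ M)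
    (hξ : ξ.origin ∈ e.source) (D : Derivation ℝ (SmoothFn n M) (SmoothFn n M))
    {X : Fin n → SmoothFn n M} (hX : ∀ i, X i =ᶠ[𝓝 ξ.origin] fun y => e y i)
    (f : SmoothFn n M) :
    ξ.toHom (D f) =
      ∑ i, ξ.toHom (D (X i)) * weilExtension (pderiv i (f ∘ e.symm)) (weilChart e ξ) := by
  obtain ⟨h, hh, hfh⟩ := exists_contDiff_germ e.open_target (e.map_source hξ)
    (contDiffOn_comp_symm he f)
  choose q hq using fun i => exists_smoothFn_germ he hξ (hh.pderiv i)
  have h1 : D f =ᶠ[𝓝 ξ.origin] (∑ i, D (X i) * q i : SmoothFn n M) := by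
    filter_upwards [e.open_source.mem_nhds hξ, Filter.eventually_all.2 hq,
      Filter.eventually_all.2 fun i => (hX i).eventually_nhds,
      (e.continuousAt hξ).eventually hfh.eventually_nhds] with y h2 h3 h4 h5
    rw [derivation_apply_eq_sum D he h2 h4, ← evalAt_apply, map_sum]
    refine Finset.sum_congr rfl fun i _ => ?_
    rw [map_mul, evalAt_apply, evalAt_apply, h3, mul_comm, Function.comp_apply,
      (Filter.EventuallyEq.pderiv h5 i).eq_of_nhds]
  rw [ξ.congr_germ h1, map_sum]
  refine Finset.sum_congr rfl fun i _ => ?_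
  rw [map_mul, toHom_eq_weilExtension_of_germ he hξ (hq i)]
  rw [← realPart_weilChart he hξ] at hfh
  rw [weilExtension_congr (hfh.pderiv i)]

end Points

/-! ### The charts of the Weil bundle -/

section Charts

variable {n : ℕ} {M : Type*} [TopologicalSpace M]
  {A : Type*} [NormedCommRing A] [NormedAlgebra ℝ A] [IsWeilAlgebra A]
  {e e' : OpenPartialHomeomorph M (EuclideanSpace ℝ (Fin n))}

theorem weilChartTarget_eq (e : OpenPartialHomeomorph M (EuclideanSpace ℝ (Fin n))) :
    weilChartTarget A e = {a | realPart a ∈ e.target} := by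
  ext a
  simp only [weilChartTarget, ← realPart_eq_iff, Set.mem_ofPred_eq]
  exact ⟨fun ⟨u, hu, h⟩ => h ▸ hu, fun h => ⟨_, h, rfl⟩⟩

theorem mem_weilChartTarget {a : Fin n → A} : a ∈ weilChartTarget A e ↔ realPart a ∈ e.target := by
  rw [weilChartTarget_eq]
  rfl

theorem isOpen_weilChartTarget (e : OpenPartialHomeomorph M (EuclideanSpace ℝ (Fin n))) :
    IsOpen (weilChartTarget A e) := by
  rw [weilChartTarget_eq]
  exact isOpen_setOf_realPart_mem e.open_target

/-- Near `a ∈ Aⁿ`, the origins of the points with given coordinates are near the origin of the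
point with coordinates `a`. -/
theorem tendsto_symm_realPart {a : Fin n → A} (ha : realPart a ∈ e.target) :
    Filter.Tendsto (fun b : Fin n → A => e.symm (realPart b)) (𝓝 a) (𝓝 (e.symm (realPart a))) :=
  (e.continuousAt_symm ha).tendsto.comp ((realPartCLM n A).continuous.tendsto a)

variable [ChartedSpace (EuclideanSpace ℝ (Fin n)) M]

theorem differentiableAt_weilExtension (he : e ∈ IsManifold.maximalAtlas (𝓡 n) ∞ M)
    (f : SmoothFn n M) {a : Fin n → A} (ha : realPart a ∈ e.target) :
    DifferentiableAt ℝ (weilExtension (f ∘ e.symm)) a :=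
  ((contDiffOn_weilExtension e.open_target (contDiffOn_comp_symm he f)).contDiffAt
    ((isOpen_setOf_realPart_mem e.open_target).mem_nhds ha)).differentiableAt (by simp)

/-- The infinitely near point with coordinates `a ∈ Aⁿ` in the chart `e`. -/
def weilPoint (he : e ∈ IsManifold.maximalAtlas (𝓡 n) ∞ M) (a : Fin n → A)
    (ha : realPart a ∈ e.target) : WeilBundle n M A where
  origin := e.symm (realPart a)
  toHom :=
    { toFun := fun f => weilExtension (f ∘ e.symm) a
      map_one' := (weilExtension_const 1 a).trans (map_one _)
      map_mul' := fun f g => weilExtension_mul e.open_target ha (contDiffOn_comp_symm he f)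
        (contDiffOn_comp_symm he g)
      map_zero' := (weilExtension_const 0 a).trans (map_zero _)
      map_add' := fun f g => weilExtension_add e.open_target ha (contDiffOn_comp_symm he f)
        (contDiffOn_comp_symm he g)
      commutes' := fun c => weilExtension_const c a }
  sub_mem := fun f => weilExtension_sub_mem (f ∘ e.symm) a

theorem weilPoint_toHom (he : e ∈ IsManifold.maximalAtlas (𝓡 n) ∞ M) (a : Fin n → A)
    (ha : realPart a ∈ e.target) (f : SmoothFn n M) :
    (weilPoint he a ha).toHom f = weilExtension (f ∘ e.symm) a := rfl

open Classical in
/-- The local expression of a function on `M^A` in the chart induced by `e`, extended by `0`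
outside the image of the chart. -/
def chartExpr (he : e ∈ IsManifold.maximalAtlas (𝓡 n) ∞ M) (φ : WeilBundle n M A → A)
    (a : Fin n → A) : A :=
  if ha : realPart a ∈ e.target then φ (weilPoint he a ha) else 0

theorem chartExpr_apply (he : e ∈ IsManifold.maximalAtlas (𝓡 n) ∞ M)
    (φ : WeilBundle n M A → A) {a : Fin n → A} (ha : realPart a ∈ e.target) :
    chartExpr he φ a = φ (weilPoint he a ha) := dif_pos ha

theorem chartExpr_add (he : e ∈ IsManifold.maximalAtlas (𝓡 n) ∞ M)
    (φ ψ : WeilBundle n M A → A) :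
    chartExpr he (φ + ψ) = fun a => chartExpr he φ a + chartExpr he ψ a := by
  ext a
  by_cases ha : realPart a ∈ e.target <;> simp [chartExpr, ha]

theorem chartExpr_mul (he : e ∈ IsManifold.maximalAtlas (𝓡 n) ∞ M)
    (φ ψ : WeilBundle n M A → A) :
    chartExpr he (φ * ψ) = fun a => chartExpr he φ a * chartExpr he ψ a := by
  ext a
  by_cases ha : realPart a ∈ e.target <;> simp [chartExpr, ha]

theorem chartExpr_smul (he : e ∈ IsManifold.maximalAtlas (𝓡 n) ∞ M) (c : A)
    (φ : WeilBundle n M A → A) :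
    chartExpr he (c • φ) = fun a => c * chartExpr he φ a := by
  ext a
  by_cases ha : realPart a ∈ e.target <;> simp [chartExpr, ha]

variable [T2Space M] [IsManifold (𝓡 n) ∞ M] {ξ : WeilBundle n M A}

theorem weilChart_weilPoint (he : e ∈ IsManifold.maximalAtlas (𝓡 n) ∞ M) (a : Fin n → A)
    (ha : realPart a ∈ e.target) : weilChart e (weilPoint he a ha) = a := by
  ext i
  obtain ⟨g, hg⟩ := exists_smoothFn_coord he (e.map_target ha) i
  rw [weilChart_apply (g := g) hg, weilPoint_toHom]
  refine (weilExtension_congr ?_).trans (weilExtension_coord i a)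
  filter_upwards [(e.continuousAt_symm ha).eventually hg, e.open_target.mem_nhds ha] with u h1 h2
  simp [h1, e.right_inv h2]

theorem realPart_weilChart_mem (he : e ∈ IsManifold.maximalAtlas (𝓡 n) ∞ M)
    (hξ : ξ.origin ∈ e.source) : realPart (weilChart e ξ) ∈ e.target := by
  rw [realPart_weilChart he hξ]
  exact e.map_source hξ

theorem weilPoint_weilChart (he : e ∈ IsManifold.maximalAtlas (𝓡 n) ∞ M)
    (hξ : ξ.origin ∈ e.source) :
    weilPoint he (weilChart e ξ) (realPart_weilChart_mem he hξ) = ξ := by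
  ext1
  · change e.symm (realPart (weilChart e ξ)) = ξ.origin
    rw [realPart_weilChart he hξ, e.left_inv hξ]
  · ext f
    rw [weilPoint_toHom, toHom_eq_weilExtension he hξ]

theorem chartExpr_weilChart (he : e ∈ IsManifold.maximalAtlas (𝓡 n) ∞ M)
    (hξ : ξ.origin ∈ e.source) (φ : WeilBundle n M A → A) :
    chartExpr he φ (weilChart e ξ) = φ ξ := by
  rw [chartExpr_apply he φ (realPart_weilChart_mem he hξ), weilPoint_weilChart he hξ]

theorem contDiffOn_chartExpr (he : e ∈ IsManifold.maximalAtlas (𝓡 n) ∞ M)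
    (φ : smoothMaps n M A) : ContDiffOn ℝ ∞ (chartExpr he φ) (weilChartTarget A e) := by
  obtain ⟨F, hF, hF'⟩ := φ.2 e he
  refine hF.congr fun a ha => ?_
  have ha' := mem_weilChartTarget.1 ha
  rw [chartExpr_apply he _ ha', hF' _ (e.map_target ha'), weilChart_weilPoint]

theorem differentiableAt_chartExpr (he : e ∈ IsManifold.maximalAtlas (𝓡 n) ∞ M)
    (φ : smoothMaps n M A) {a : Fin n → A} (ha : realPart a ∈ e.target) :
    DifferentiableAt ℝ (chartExpr he φ) a :=
  ((contDiffOn_chartExpr he φ).contDiffAt ((isOpen_weilChartTarget e).mem_nhds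
    (mem_weilChartTarget.2 ha))).differentiableAt (by simp)

theorem isSmooth_of_contDiffOn_chartExpr {φ : WeilBundle n M A → A}
    (h : ∀ e (he : e ∈ IsManifold.maximalAtlas (𝓡 n) ∞ M),
      ContDiffOn ℝ ∞ (chartExpr he φ) (weilChartTarget A e)) : IsSmooth φ :=
  fun e he => ⟨_, h e he, fun _ hξ => (chartExpr_weilChart he hξ φ).symm⟩

theorem isSmooth_prolong (f : SmoothFn n M) : IsSmooth (prolong f : WeilBundle n M A → A) := by
  refine isSmooth_of_contDiffOn_chartExpr fun e he => ?_
  have h := contDiffOn_weilExtension (A := A) e.open_target (contDiffOn_comp_symm he f)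
  rw [← weilChartTarget_eq] at h
  exact h.congr fun a ha => chartExpr_apply he _ (mem_weilChartTarget.1 ha)

variable (n M A) in
/-- Prolongation `f ↦ f^A` as a linear map. -/
def prolongLinear : SmoothFn n M →ₗ[ℝ] smoothMaps n M A where
  toFun f := ⟨prolong f, isSmooth_prolong f⟩
  map_add' f g := Subtype.ext <| funext fun ξ => map_add ξ.toHom f g
  map_smul' c f := Subtype.ext <| funext fun ξ => map_smul ξ.toHom c f

/-! ### The vector field on the Weil bundle induced by a derivation -/

open Classical in
/-- A globally defined smooth function which agrees near `x` with the `i`-th coordinate of the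
chart `e`; it is `0` if there is none, which does not happen for `x` in the domain of `e`. -/
def coordExt (e : OpenPartialHomeomorph M (EuclideanSpace ℝ (Fin n))) (x : M) (i : Fin n) :
    SmoothFn n M :=
  if h : ∃ g : SmoothFn n M, g =ᶠ[𝓝 x] fun y => e y i then h.choose else 0

theorem coordExt_eventuallyEq (he : e ∈ IsManifold.maximalAtlas (𝓡 n) ∞ M) {x : M}
    (hx : x ∈ e.source) (i : Fin n) : coordExt e x i =ᶠ[𝓝 x] fun y => e y i := by
  have h := exists_smoothFn_coord he hx i
  rw [coordExt, dif_pos h]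
  exact h.choose_spec

variable (D : Derivation ℝ (SmoothFn n M) (SmoothFn n M))

/-- The components at `ξ`, in the chart induced by `e`, of the prolongation to `M^A` of the
vector field `D`: they are the values of `ξ` at the components of `D`. -/
def prolongVector (e : OpenPartialHomeomorph M (EuclideanSpace ℝ (Fin n)))
    (ξ : WeilBundle n M A) : Fin n → A :=
  fun i => ξ.toHom (D (coordExt e ξ.origin i))

theorem prolongVector_apply (he : e ∈ IsManifold.maximalAtlas (𝓡 n) ∞ M)
    (hξ : ξ.origin ∈ e.source) {i : Fin n} {g : SmoothFn n M}
    (hg : g =ᶠ[𝓝 ξ.origin] fun y => e y i) : prolongVector D e ξ i = ξ.toHom (D g) :=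
  ξ.congr_germ (derivation_congr_germ D ((coordExt_eventuallyEq he hξ i).trans hg.symm))

/-- Along the prolonged vector field, the function `f^A` has the derivative `(Df)^A`. -/
theorem fderiv_weilExtension_prolongVector (he : e ∈ IsManifold.maximalAtlas (𝓡 n) ∞ M)
    (hξ : ξ.origin ∈ e.source) (f : SmoothFn n M) :
    fderiv ℝ (weilExtension (f ∘ e.symm)) (weilChart e ξ) (prolongVector D e ξ) =
      ξ.toHom (D f) := by
  rw [fderiv_weilExtension e.open_target (realPart_weilChart_mem he hξ)
    (contDiffOn_comp_symm he f),
    toHom_derivation_eq_sum he hξ D (fun i => coordExt_eventuallyEq he hξ i)]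
  rfl

/-- The derivative of a smooth function on `M^A` along the prolonged vector field does not depend
on the chart in which it is computed: the transition map of the charts is the extension to `Aⁿ`
of the transition map of the charts of `M`. -/
theorem fderiv_chartExpr_prolongVector_eq (he : e ∈ IsManifold.maximalAtlas (𝓡 n) ∞ M)
    (he' : e' ∈ IsManifold.maximalAtlas (𝓡 n) ∞ M) (hξ : ξ.origin ∈ e.source)
    (hξ' : ξ.origin ∈ e'.source) (φ : smoothMaps n M A) :
    fderiv ℝ (chartExpr he φ) (weilChart e ξ) (prolongVector D e ξ) =
      fderiv ℝ (chartExpr he' φ) (weilChart e' ξ) (prolongVector D e' ξ) := by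
  let X := coordExt e' ξ.origin
  have hX := coordExt_eventuallyEq he' hξ'
  let τ : (Fin n → A) → (Fin n → A) := fun a i => weilExtension (X i ∘ e.symm) a
  have ha := realPart_weilChart_mem he hξ
  have h0 : e.symm (realPart (weilChart e ξ)) = ξ.origin := by
    rw [realPart_weilChart he hξ, e.left_inv hξ]
  have hlim := tendsto_symm_realPart ha
  rw [h0] at hlim
  have hτ : chartExpr he φ =ᶠ[𝓝 (weilChart e ξ)] chartExpr he' φ ∘ τ := by
    filter_upwards [hlim.eventually (e'.open_source.mem_nhds hξ'),
      hlim.eventually (Filter.eventually_all.2 fun i => (hX i).eventually_nhds),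
      (isOpen_setOf_realPart_mem e.open_target).mem_nhds ha] with b h1 h2 h3
    rw [chartExpr_apply he _ h3, ← chartExpr_weilChart he' (ξ := weilPoint he b h3) h1 φ]
    refine congrArg (chartExpr he' (φ : WeilBundle n M A → A)) (funext fun i => ?_)
    exact weilChart_apply (ξ := weilPoint he b h3) (h2 i)
  have hτ0 : τ (weilChart e ξ) = weilChart e' ξ := by
    ext i
    rw [weilChart_apply (hX i), toHom_eq_weilExtension he hξ]
  have hτd : HasFDerivAt τ (ContinuousLinearMap.pi fun i =>
      fderiv ℝ (weilExtension (X i ∘ e.symm)) (weilChart e ξ)) (weilChart e ξ) :=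
    hasFDerivAt_pi.2 fun i => (differentiableAt_weilExtension he (X i) ha).hasFDerivAt
  have hφ := (differentiableAt_chartExpr he' φ (realPart_weilChart_mem he' hξ')).hasFDerivAt
  rw [← hτ0] at hφ
  rw [hτ.fderiv_eq, (hφ.comp _ hτd).fderiv, ContinuousLinearMap.comp_apply, hτ0]
  congr 1
  ext i
  exact fderiv_weilExtension_prolongVector D he hξ (X i)

/-- The derivative of `φ` along the prolongation of `D` to `M^A`. -/
def tildeFun (φ : WeilBundle n M A → A) (ξ : WeilBundle n M A) : A :=
  fderiv ℝ (chartExpr (IsManifold.chart_mem_maximalAtlas (I := 𝓡 n) (n := ∞) ξ.origin) φ)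
    (weilChart (chartAt _ ξ.origin) ξ) (prolongVector D (chartAt _ ξ.origin) ξ)

theorem tildeFun_eq (he : e ∈ IsManifold.maximalAtlas (𝓡 n) ∞ M) (hξ : ξ.origin ∈ e.source)
    (φ : smoothMaps n M A) : tildeFun D φ ξ =
      fderiv ℝ (chartExpr he φ) (weilChart e ξ) (prolongVector D e ξ) :=
  fderiv_chartExpr_prolongVector_eq D _ he (mem_chart_source _ _) hξ φ

theorem contDiffOn_prolongVector (he : e ∈ IsManifold.maximalAtlas (𝓡 n) ∞ M) (i : Fin n) :
    ContDiffOn ℝ ∞ (chartExpr he fun ξ : WeilBundle n M A => prolongVector D e ξ i)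
      (weilChartTarget A e) := by
  intro a ha
  rw [mem_weilChartTarget] at ha
  -- near `a`, the coordinate functions can be extended independently of the point
  let g := coordExt e (e.symm (realPart a)) i
  have h1 : ContDiffAt ℝ ∞ (weilExtension (D g ∘ e.symm)) a :=
    (contDiffOn_weilExtension e.open_target (contDiffOn_comp_symm he (D g))).contDiffAt
      ((isOpen_setOf_realPart_mem e.open_target).mem_nhds ha)
  refine (h1.congr_of_eventuallyEq ?_).contDiffWithinAt
  filter_upwards [(isOpen_setOf_realPart_mem e.open_target).mem_nhds ha,
    (tendsto_symm_realPart ha).eventually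
      (coordExt_eventuallyEq he (e.map_target ha) i).eventually_nhds] with b hb hg
  rw [chartExpr_apply he _ hb]
  exact prolongVector_apply D he (ξ := weilPoint he b hb) (e.map_target hb) hg

theorem isSmooth_tildeFun (φ : smoothMaps n M A) :
    IsSmooth (tildeFun D (φ : WeilBundle n M A → A)) := by
  refine isSmooth_of_contDiffOn_chartExpr fun e he => ?_
  have h1 := (contDiffOn_chartExpr he φ).fderiv_of_isOpen (isOpen_weilChartTarget e) (m := ∞)
    (by simp)
  refine (h1.clm_apply (contDiffOn_pi.2 fun i => contDiffOn_prolongVector D he i)).congr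
    fun a ha => ?_
  rw [mem_weilChartTarget] at ha
  rw [chartExpr_apply he _ ha, tildeFun_eq D he (e.map_target ha), weilChart_weilPoint he]
  simp only [chartExpr_apply he _ ha]

variable (A) in
/-- The derivation of `C^∞(M^A, A)` induced by a derivation `D` of `C^∞(M)`. -/
def tildeDerivation : Derivation A (smoothMaps n M A) (smoothMaps n M A) :=
  Derivation.mk'
    { toFun := fun φ => ⟨tildeFun D (φ : WeilBundle n M A → A), isSmooth_tildeFun D φ⟩
      map_add' := fun φ ψ => Subtype.ext <| funext fun ξ => by
        have ha := realPart_weilChart_mem (A := A)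
          (IsManifold.chart_mem_maximalAtlas (I := 𝓡 n) (n := ∞) ξ.origin)
          (mem_chart_source _ ξ.origin)
        simp [tildeFun, chartExpr_add, fderiv_fun_add (differentiableAt_chartExpr _ φ ha)
          (differentiableAt_chartExpr _ ψ ha)]
      map_smul' := fun c φ => Subtype.ext <| funext fun ξ => by
        have ha := realPart_weilChart_mem (A := A)
          (IsManifold.chart_mem_maximalAtlas (I := 𝓡 n) (n := ∞) ξ.origin)
          (mem_chart_source _ ξ.origin)
        simp [tildeFun, chartExpr_smul, fderiv_const_mul (differentiableAt_chartExpr _ φ ha)] }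
    fun φ ψ => Subtype.ext <| funext fun ξ => by
      have hs := mem_chart_source (EuclideanSpace ℝ (Fin n)) ξ.origin
      have ha := realPart_weilChart_mem (A := A)
        (IsManifold.chart_mem_maximalAtlas (I := 𝓡 n) (n := ∞) ξ.origin) hs
      simp [tildeFun, chartExpr_mul, fderiv_fun_mul (differentiableAt_chartExpr _ φ ha)
        (differentiableAt_chartExpr _ ψ ha), chartExpr_weilChart _ hs]

@[simp] theorem tildeDerivation_apply (φ : smoothMaps n M A) :
    (tildeDerivation A D φ : WeilBundle n M A → A) = tildeFun D (φ : WeilBundle n M A → A) := rfl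

theorem isRealValued_tildeDerivation {φ : smoothMaps n M A} (hφ : IsRealValued φ) :
    IsRealValued (tildeDerivation A D φ) := by
  intro ξ
  set he := IsManifold.chart_mem_maximalAtlas (I := 𝓡 n) (n := ∞) ξ.origin
  -- the local expression is fixed by the projection of `A` onto its real part
  let L : A →L[ℝ] A :=
    (Algebra.linearMap ℝ A ∘ₗ (augmentation A).toLinearMap).toContinuousLinearMap
  have hL : ∀ c, L c = algebraMap ℝ A (augmentation A c) := fun c => rfl
  have h1 : chartExpr he φ = L ∘ chartExpr he φ := by
    ext a
    rw [Function.comp_apply]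
    by_cases ha : realPart a ∈ (chartAt (EuclideanSpace ℝ (Fin n)) ξ.origin).target
    · obtain ⟨r, hr⟩ := hφ (weilPoint he a ha)
      rw [chartExpr_apply he _ ha, ← hr, hL, AlgHom.commutes]
      rfl
    · simp [chartExpr, ha]
  have hd := differentiableAt_chartExpr he φ
    (realPart_weilChart_mem he (mem_chart_source _ ξ.origin))
  have h2 := (L.hasFDerivAt.comp _ hd.hasFDerivAt).fderiv
  rw [← h1] at h2
  refine ⟨augmentation A (tildeFun D (φ : WeilBundle n M A → A) ξ), ?_⟩
  rw [← hL]
  exact (DFunLike.congr_fun h2 _).symm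

theorem tildeFun_prolong (f : SmoothFn n M) :
    tildeFun D (prolong f : WeilBundle n M A → A) = prolong (D f) := by
  ext ξ
  have hs := mem_chart_source (EuclideanSpace ℝ (Fin n)) ξ.origin
  have he := IsManifold.chart_mem_maximalAtlas (I := 𝓡 n) (n := ∞) ξ.origin
  refine Eq.trans ?_ (fderiv_weilExtension_prolongVector D he hs f)
  have h : chartExpr he (prolong f : WeilBundle n M A → A) =ᶠ[𝓝 (weilChart (chartAt _ ξ.origin) ξ)]
      weilExtension (f ∘ (chartAt (EuclideanSpace ℝ (Fin n)) ξ.origin).symm) := by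
    filter_upwards [(isOpen_weilChartTarget _).mem_nhds
      (mem_weilChartTarget.2 (realPart_weilChart_mem he hs))] with a ha
    exact chartExpr_apply he _ (mem_weilChartTarget.1 ha)
  rw [← h.fderiv_eq]
  rfl

variable (n M A) in
/-- The assignment `D ↦ tildeDerivation D` is real linear. -/
def tildeLinear : Derivation ℝ (SmoothFn n M) (SmoothFn n M) →ₗ[ℝ]
    Derivation A (smoothMaps n M A) (smoothMaps n M A) where
  toFun := tildeDerivation A
  map_add' D D' := by
    ext φ ξ
    have : prolongVector (D + D') (chartAt _ ξ.origin) ξ =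
        prolongVector D (chartAt _ ξ.origin) ξ + prolongVector D' (chartAt _ ξ.origin) ξ := by
      ext i
      simp [prolongVector]
    simp [tildeDerivation_apply, tildeFun, this]
  map_smul' c D := by
    ext φ ξ
    have : prolongVector (c • D) (chartAt _ ξ.origin) ξ =
        c • prolongVector D (chartAt _ ξ.origin) ξ := by
      ext i
      simp [prolongVector]
    simp [tildeDerivation_apply, tildeFun, this]

end Charts

/-! ### Poisson brackets and cochains -/

/-- The coboundary formula is natural in the coefficient representation. -/
theorem ceFormula_map {L V W : Type*} [AddCommGroup L] [Module ℝ L] [AddCommGroup V] [Module ℝ V]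
    [AddCommGroup W] [Module ℝ W] (br : L →ₗ[ℝ] L →ₗ[ℝ] L) {ρ : L →ₗ[ℝ] V →ₗ[ℝ] V}
    {σ : L →ₗ[ℝ] W →ₗ[ℝ] W} {T : V →ₗ[ℝ] W} (hT : ∀ x v, σ x (T v) = T (ρ x v)) {p : ℕ}
    (Ω : (Fin p → L) → V) (f : Fin (p + 1) → L) :
    ceFormula br σ (fun g => T (Ω g)) f = T (ceFormula br ρ Ω f) := by
  cases p <;> simp [ceFormula, hT]

section Poisson

variable {n : ℕ} {M : Type*} [TopologicalSpace M]
  [ChartedSpace (EuclideanSpace ℝ (Fin n)) M]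

/-- The adjoint representation `f ↦ {f, ·}` with values in the derivations of `C^∞(M)`. -/
def PoissonBracket.ad (P : PoissonBracket n M) :
    SmoothFn n M →ₗ[ℝ] Derivation ℝ (SmoothFn n M) (SmoothFn n M) where
  toFun f := Derivation.mk' (P.bracket f) fun g h => by
    rw [P.leibniz, smul_eq_mul, smul_eq_mul]
    ring
  map_add' f g := by ext1 h; simp
  map_smul' c f := by ext1 h; simp

variable [T2Space M] [IsManifold (𝓡 n) ∞ M]
  {A : Type*} [NormedCommRing A] [NormedAlgebra ℝ A] [IsWeilAlgebra A]

theorem PoissonBracket.isTildeOf_tildeAd (P : PoissonBracket n M) (f : SmoothFn n M) :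
    IsTildeOf (P.adProlong f) (P.tildeAd A f) := by
  have h : ∃ ρ : SmoothFn n M →ₗ[ℝ] Derivation A (smoothMaps n M A) (smoothMaps n M A),
      ∀ f, IsTildeOf (P.adProlong f) (ρ f) :=
    ⟨tildeLinear n M A ∘ₗ P.ad, fun f =>
      { real := fun φ hφ => isRealValued_tildeDerivation (P.ad f) hφ
        prolong := fun g φ hφ => by
          change tildeFun (P.ad f) (φ : WeilBundle n M A → A) = _
          rw [hφ, tildeFun_prolong]
          rfl }⟩
  rw [tildeAd, dif_pos h]
  exact h.choose_spec f

theorem PoissonBracket.tildeAdEnd_prolongLinear (P : PoissonBracket n M) (f g : SmoothFn n M) :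
    P.tildeAdEnd A f (prolongLinear n M A g) = prolongLinear n M A (P.bracket f g) :=
  Subtype.ext ((P.isTildeOf_tildeAd f).prolong g (prolongLinear n M A g) rfl)

end Poisson

end WeilPoisson

end

theorem mainTheorem2 {n : ℕ} {M : Type*} [TopologicalSpace M] [T2Space M] [ParacompactSpace M]
    [ChartedSpace (EuclideanSpace ℝ (Fin n)) M] [IsManifold (𝓡 n) ∞ M]
    {A : Type*} [NormedCommRing A] [NormedAlgebra ℝ A] [WeilPoisson.IsWeilAlgebra A]
    (P : WeilPoisson.PoissonBracket n M) :
    (∀ f : WeilPoisson.SmoothFn n M,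
      WeilPoisson.IsTildeOf (P.adProlong f) (P.tildeAd A f)) ∧
    ∀ (p : ℕ) (η : WeilPoisson.PoissonForm n M p),
      ∃ (ηA : WeilPoisson.WeilForm n M A p) (dηA : WeilPoisson.WeilForm n M A (p + 1)),
        WeilPoisson.IsProlongation η ηA ∧ WeilPoisson.IsProlongation (P.d η) dηA ∧
        P.dTilde ηA = dηA := by
  refine ⟨P.isTildeOf_tildeAd, fun p η =>
    ⟨(WeilPoisson.prolongLinear n M A).compAlternatingMap η,
      (WeilPoisson.prolongLinear n M A).compAlternatingMap (P.d η),
      fun _ => rfl, fun _ => rfl, ?_⟩⟩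
  ext1 f
  exact WeilPoisson.ceFormula_map (T := WeilPoisson.prolongLinear n M A) P.bracket
    P.tildeAdEnd_prolongLinear η f
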